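/- Let $\upsilon$ be an indeterminate and let $\mathbf U(\infty)$ be the associative unital $\mathbb Q(\upsilon)$-algebra with generators $E_i,F_i,K_i,K_i^{-1}$ $(i\in\mathbb Z)$ and relations, where $\widetilde K_i=K_iK_{i+1}^{-1}$, $$K_iK_j=K_jK_i,\qquad K_iK_i^{-1}=K_i^{-1}K_i=1,\qquad K_iE_j=\upsilon^{\delta_{i,j}-\delta_{i,j+1}}E_jK_i,\qquad K_iF_j=\upsilon^{\delta_{i,j+1}-\delta_{i,j}}F_jK_i,$$ $$E_iE_j=E_jE_i,\quad F_iF_j=F_jF_i\quad(|i-j|>1),\qquad E_iF_j-F_jE_i=\delta_{i,j}\frac{\widetilde K_i-\widetilde K_i^{-1}}{\upsilon-\upsilon^{-1}},$$ $$E_i^2E_j-(\upsilon+\upsilon^{-1})E_iE_jE_i+E_jE_i^2=0,\quad F_i^2F_j-(\upsilon+\upsilon^{-1})F_iF_jF_i+F_jF_i^2=0\quad(|i-j|=1).$$ Let $X(\infty)=\mathbb Z^{\mathbb Z}$ be the set of all sequences $\lambda=(\lambda_i)_{i\in\mathbb Z}$ of integers and $X^+(\infty)=\{\lambda\in X(\infty)\mid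 \lambda_i\ge\lambda_{i+1}\ \forall i\in\mathbb Z\}$ the set of dominant weights. Put $\alpha_i=\boldsymbol e_i-\boldsymbol e_{i+1}$, where $\boldsymbol e_i$ is the $i$-th unit sequence, and write $\mu\le\lambda$ if $\lambda-\mu$ is a finite sum of elements $\alpha_i$, repetitions and the empty sum being allowed. For a (left) $\mathbf U(\infty)$-module $M$ let $M_\lambda=\{x\in M\mid K_ix=\upsilon^{\lambda_i}x\ \forall i\in\mathbb Z\}$. Call $M$ a weight module if $M=\bigoplus_{\lambda\in X(\infty)}M_\lambda$. Consider the following full subcategories of the category of weight modules. * $\mathcal C^{int}$ (integrable modules): for all $x\in M$ and $i\in\mathbb Z$ there is $n_0\ge1$ with $E_i^nx=F_i^nx=0$ for all $n\ge n_0$. * $\mathcal C^{hi}$: for all $x\in M$ there is $n_0\ge 1$ such that $E_{i_1}\cdots E_{i_n}x=0$ for all $n\ge n_0$ and all $i_1,\dots,i_n\in\mathbb Z$. * $\mathcal O$: every $M_\lambda$ is finite dimensional over $\mathbb Q(\upsilon)$, and there are finitely many $\lambda^{(1)},\dots,\lambda^{(s)}\in X(\infty)$ such that every $\mu$ with $M_\mu\ne0$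 satisfies $\mu\le\lambda^{(k)}$ for some $k$. For $\lambda\in X(\infty)$ let $M(\lambda)=\mathbf U(\infty)\big/\big(\sum_i\mathbf U(\infty)E_i+\sum_i\mathbf U(\infty)(K_i-\upsilon^{\lambda_i})\big)$ be the Verma module, and let $L(\lambda)$ be its unique irreducible quotient, that is, the quotient of $M(\lambda)$ by the sum of all its proper submodules. Then: 1. $\lambda\mapsto L(\lambda)$ defines a bijection from $X^+(\infty)$ to the set of isomorphism classes of irreducible $\mathbf U(\infty)$-modules in $\mathcal C^{int}\cap\mathcal C^{hi}$. 2. $\lambda\mapsto L(\lambda)$ defines a bijection from $X^+(\infty)$ to the set of isomorphism classes of irreducible $\mathbf U(\infty)$-modules in $\mathcal C^{int}\cap\mathcal O$. 3. For every $\lambda\in X(\infty)$, the module $L(\lambda)$ is integrable if and only if $\lambda\in X^+(\infty)$. -/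

import Mathlib

open CategoryTheory

universe u v

noncomputable section

namespace QuantumGLInf

/-- The base field `ℚ(υ)` of rational functions. -/
abbrev Base : Type := RatFunc ℚ

/-- The indeterminate `υ`. -/
abbrev ups : Base := RatFunc.X

/-- The generators `E_i`, `F_i`, `K_i`, `K_i⁻¹` with `i ∈ ℤ`. -/
inductive Gen : Type
  | E (i : ℤ)
  | F (i : ℤ)
  | K (i : ℤ)
  | Kinv (i : ℤ)

/-- The free associative unital `ℚ(υ)`-algebra on the generators. -/
abbrev Free : Type := FreeAlgebra Base Gen

/-- A generator as an element of the free algebra. -/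
abbrev gen (g : Gen) : Free := FreeAlgebra.ι Base g

/-- The Kronecker delta with values in `ℤ`. -/
def delta (i j : ℤ) : ℤ := if i = j then 1 else 0

open Gen in
/-- The defining relations of quantum `𝔤𝔩_∞`. -/
inductive Rel : Free → Free → Prop
  | K_comm (i j : ℤ) : Rel (gen (K i) * gen (K j)) (gen (K j) * gen (K i))
  | K_mul_Kinv (i : ℤ) : Rel (gen (K i) * gen (Kinv i)) 1
  | Kinv_mul_K (i : ℤ) : Rel (gen (Kinv i) * gen (K i)) 1
  | K_E (i j : ℤ) : Rel (gen (K i) * gen (E j))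
      (ups ^ (delta i j - delta i (j + 1)) • (gen (E j) * gen (K i)))
  | K_F (i j : ℤ) : Rel (gen (K i) * gen (F j))
      (ups ^ (delta i (j + 1) - delta i j) • (gen (F j) * gen (K i)))
  | E_comm (i j : ℤ) (h : 1 < |i - j|) : Rel (gen (E i) * gen (E j)) (gen (E j) * gen (E i))
  | F_comm (i j : ℤ) (h : 1 < |i - j|) : Rel (gen (F i) * gen (F j)) (gen (F j) * gen (F i))
  | E_F_same (i : ℤ) : Rel (gen (E i) * gen (F i) - gen (F i) * gen (E i))
      ((ups - ups⁻¹)⁻¹ • (gen (K i) * gen (Kinv (i + 1)) - gen (K (i + 1)) * gen (Kinv i)))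
  | E_F_ne (i j : ℤ) (h : i ≠ j) : Rel (gen (E i) * gen (F j) - gen (F j) * gen (E i)) 0
  | E_serre (i j : ℤ) (h : |i - j| = 1) :
      Rel (gen (E i) ^ 2 * gen (E j) - (ups + ups⁻¹) • (gen (E i) * gen (E j) * gen (E i))
        + gen (E j) * gen (E i) ^ 2) 0
  | F_serre (i j : ℤ) (h : |i - j| = 1) :
      Rel (gen (F i) ^ 2 * gen (F j) - (ups + ups⁻¹) • (gen (F i) * gen (F j) * gen (F i))
        + gen (F j) * gen (F i) ^ 2) 0

/-- Quantum `𝔤𝔩_∞`: the `ℚ(υ)`-algebra `𝐔(∞)` given by the generators and relations above. -/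
def U : Type := RingQuot Rel

instance instRingU : Ring U := inferInstanceAs (Ring (RingQuot Rel))

instance instAlgebraU : Algebra Base U := inferInstanceAs (Algebra Base (RingQuot Rel))

/-- The quotient map from the free algebra onto `𝐔(∞)`. -/
def mkU : Free →ₐ[Base] U := RingQuot.mkAlgHom Base Rel

/-- The generator `E_i` of `𝐔(∞)`. -/
def E (i : ℤ) : U := mkU (gen (Gen.E i))

/-- The generator `F_i` of `𝐔(∞)`. -/
def F (i : ℤ) : U := mkU (gen (Gen.F i))

/-- The generator `K_i` of `𝐔(∞)`. -/
def K (i : ℤ) : U := mkU (gen (Gen.K i))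

/-- The weights: `X(∞) = ∏_{i ∈ ℤ} ℤ`, all two-sided integer sequences. -/
abbrev Weight : Type := ℤ → ℤ

/-- The set `X⁺(∞)` of dominant weights. -/
def dominant : Set Weight := {lam | ∀ i, lam (i + 1) ≤ lam i}

/-- The simple root `α_i = e_i - e_{i+1}`. -/
def simpleRoot (i : ℤ) : Weight := Pi.single i 1 - Pi.single (i + 1) 1

/-- The order on weights: `μ ≤ λ` when `λ - μ` is a (finite) sum of simple roots. -/
def WtLE (mu lam : Weight) : Prop :=
  lam - mu ∈ AddSubmonoid.closure (Set.range simpleRoot)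

section Modules

variable (M : Type v) [AddCommGroup M] [Module Base M] [Module U M] [IsScalarTower Base U M]

/-- The weight space `M_λ = {x | K_i x = υ^{λ_i} x for all i}`, a `ℚ(υ)`-subspace of `M`.
The action of `ℚ(υ)` on `M` is the one induced by the action of `𝐔(∞)`. -/
def weightSpace (lam : Weight) : Submodule Base M where
  carrier := {x | ∀ i, K i • x = ups ^ lam i • x}
  add_mem' := by
    intro x y hx hy i
    rw [smul_add, smul_add, hx i, hy i]
  zero_mem' := by
    intro i
    rw [smul_zero, smul_zero]
  smul_mem' := by
    intro c x hx i
    rw [smul_comm (K i) c x, hx i, smul_comm]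

open Classical in
/-- Weight modules: `M` is the direct sum of its weight spaces. -/
def IsWeightModule : Prop := DirectSum.IsInternal (weightSpace M)

/-- Integrable weight modules: all `E_i` and `F_i` act locally nilpotently. -/
def IsIntegrable : Prop :=
  IsWeightModule M ∧
    ∀ (x : M) (i : ℤ), ∃ n₀ : ℕ, 1 ≤ n₀ ∧ ∀ n ≥ n₀, E i ^ n • x = 0 ∧ F i ^ n • x = 0

/-- The weight modules in `𝒞^hi`: each vector is killed by all monomials
`E_{i_1} ⋯ E_{i_n}` of sufficiently large degree. -/
def IsHi : Prop :=
  IsWeightModule M ∧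
    ∀ x : M, ∃ n₀ : ℕ, 1 ≤ n₀ ∧ ∀ l : List ℤ, n₀ ≤ l.length → (l.map E).prod • x = 0

/-- The modules in `𝒪`: weight modules with finite dimensional weight spaces whose weights all
lie below one of finitely many weights. -/
def IsCatO : Prop :=
  IsWeightModule M ∧
    (∀ lam : Weight, FiniteDimensional Base (weightSpace M lam)) ∧
    ∃ s : Finset Weight, ∀ mu : Weight, weightSpace M mu ≠ ⊥ → ∃ lam ∈ s, WtLE mu lam

end Modules

section Categories

-- A `𝐔(∞)`-module is a `ℚ(υ)`-vector space through `ℚ(υ) → 𝐔(∞)`.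
open scoped ModuleCat.Algebra

/-- The full subcategory `𝒞^int` of `𝐔(∞)`-modules. -/
def Cint : ObjectProperty (ModuleCat.{u} U) := fun M => IsIntegrable M

/-- The full subcategory `𝒞^hi` of `𝐔(∞)`-modules. -/
def Chi : ObjectProperty (ModuleCat.{u} U) := fun M => IsHi M

/-- The full subcategory `𝒪` of `𝐔(∞)`-modules. -/
def CatO : ObjectProperty (ModuleCat.{u} U) := fun M => IsCatO M

end Categories

/-- The left ideal of `𝐔(∞)` generated by all `E_i` and all `K_i - υ^{λ_i}`. -/
def vermaIdeal (lam : Weight) : Submodule U U :=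
  Submodule.span U
    (Set.range E ∪ Set.range fun i => K i - algebraMap Base U (ups ^ lam i))

/-- The Verma module `M(λ)`. -/
abbrev Verma (lam : Weight) : Type := U ⧸ vermaIdeal lam

/-- The sum of all proper submodules of `M(λ)`, which is its unique maximal submodule. -/
def maxSubmodule (lam : Weight) : Submodule U (Verma lam) :=
  sSup {N : Submodule U (Verma lam) | N ≠ ⊤}

/-- The module `L(λ)`, the unique irreducible quotient of `M(λ)`. -/
abbrev L (lam : Weight) : Type := Verma lam ⧸ maxSubmodule lam

/-- `L(λ)` as an object of the category of `𝐔(∞)`-modules (in any universe). -/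
def Lobj (lam : Weight) : ModuleCat.{u} U := ModuleCat.of U (ULift.{u} (L lam))

/-- Isomorphism classes of `𝐔(∞)`-modules. -/
abbrev IsoClass : Type (u + 1) := Quotient (isIsomorphicSetoid (ModuleCat.{u} U))

/-- The isomorphism class of a `𝐔(∞)`-module. -/
def isoClass (M : ModuleCat.{u} U) : IsoClass.{u} := Quotient.mk _ M

/-- The set of isomorphism classes of irreducible `𝐔(∞)`-modules in a full subcategory. -/
def irrClasses (P : ObjectProperty (ModuleCat.{u} U)) : Set IsoClass.{u} :=
  {c | ∃ M : ModuleCat.{u} U, P M ∧ IsSimpleModule U M ∧ isoClass M = c}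

end QuantumGLInf

end

noncomputable section

namespace QuantumGLInf

/-! ### The indeterminate -/

/-! Everything reduces to singular vectors. In a simple module of `𝒞^hi`, a longest monomial in the
`E_i` that does not kill a given weight vector produces a singular vector
(`IsHi.exists_isHighestWeight`), which generates, so the module is `L(λ)`
(`IsHighestWeight.nonempty_equiv_L`). The weight `λ` is determined because all weights of a highest
weight module lie below `λ` and the order is antisymmetric (`IsHighestWeight.weight_unique`).

Dominance is a rank one matter. With `a = λ_i - λ_{i+1}`, one has `E_i F_i^{n+1} v = [n+1][a-n]
F_i^n v` (`IsSingular.E_F_pow_smul`). If `F_i` is nilpotent on `v`, the first vanishing power forces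
`a = n ≥ 0`. Conversely, if `a = n ≥ 0`, then `F_i^{n+1} v` is singular of a weight other than `λ`,
hence zero in a simple module; the Serre relations spread nilpotency from `v` to all monomials
(`exists_F_pow_mul_F`). Nilpotency of the `E_i` is free, because highest weight modules lie in `𝒪`,
hence in `𝒞^hi`. Finite dimensionality of weight spaces comes from the linear independence of the
simple roots (`perm_of_wt_eq`).

It remains to see that `M(λ) ≠ 0`. For this the generators act on the free space on words in the
`F_i`, with `E_i` defined by the commutator rule. Serre elements commute with the opposite
generators (`WeakRel.commute_serreElement`). Hence those in the `E_i` vanish on words, while those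
in the `F_i` span, together with their `F`-multiples, a stable subspace avoiding the empty word. The
quotient by it is a `𝐔(∞)`-module with a nonzero singular vector. -/

lemma ups_ne_zero : ups ≠ 0 := RatFunc.X_ne_zero

lemma intDegree_ups_pow (n : ℕ) : (ups ^ n).intDegree = n := by
  induction n with
  | zero => simp
  | succ n ih =>
    rw [pow_succ, RatFunc.intDegree_mul (pow_ne_zero _ ups_ne_zero) ups_ne_zero, ih,
      RatFunc.intDegree_X]
    push_cast; rfl

/-- The degree of `υ^n` is `n`, so `υ` is not a root of unity. This separates the weights and keeps
`[n]` nonzero for `n ≠ 0`. -/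
lemma ups_zpow_eq_one {a : ℤ} (h : ups ^ a = 1) : a = 0 := by
  have key : ∀ n : ℕ, ups ^ n = 1 → n = 0 := fun n hn => by
    have := intDegree_ups_pow n
    rw [hn, RatFunc.intDegree_one] at this
    exact_mod_cast this.symm
  obtain ⟨n, rfl | rfl⟩ := a.eq_nat_or_neg
  · rw [zpow_natCast] at h
    rw [key n h, Nat.cast_zero]
  · rw [zpow_neg, inv_eq_one, zpow_natCast] at h
    rw [key n h, Nat.cast_zero, neg_zero]

lemma ups_zpow_injective : Function.Injective fun a : ℤ => ups ^ a := by
  intro a b h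
  have h1 : ups ^ (a - b) = 1 := by
    rw [zpow_sub₀ ups_ne_zero, show ups ^ a = ups ^ b from h,
      div_self (zpow_ne_zero _ ups_ne_zero)]
  have := ups_zpow_eq_one h1
  omega

lemma ups_sub_inv_ne_zero : ups - ups⁻¹ ≠ 0 := by
  intro h
  have h1 : ups ^ (1 : ℤ) = ups ^ (-1 : ℤ) := by
    rw [zpow_one, zpow_neg_one]; exact sub_eq_zero.mp h
  have := ups_zpow_injective h1
  omega

/-- The quantum integer `[n] = (υ^n - υ^{-n}) / (υ - υ⁻¹)`. -/
def qint (n : ℤ) : Base := (ups - ups⁻¹)⁻¹ * (ups ^ n - ups ^ (-n))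

lemma qint_zero : qint 0 = 0 := by simp [qint]

lemma qint_eq_zero_iff {n : ℤ} : qint n = 0 ↔ n = 0 := by
  refine ⟨fun h => ?_, fun h => by rw [h, qint_zero]⟩
  rcases mul_eq_zero.mp h with h | h
  · exact absurd h (inv_ne_zero ups_sub_inv_ne_zero)
  · have := ups_zpow_injective (sub_eq_zero.mp h)
    omega

/-- The recursion behind `E F^{m+1} v = [m+1] [a-m] F^m v`. -/
lemma qint_recursion (m a : ℤ) :
    qint m * qint (a - m + 1) + qint (a - 2 * m) = qint (m + 1) * qint (a - m) := by
  have h0 := ups_ne_zero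
  have h1 := ups_sub_inv_ne_zero
  have hm := zpow_ne_zero m h0
  have ha := zpow_ne_zero a h0
  have h2 : ups ^ 2 - 1 ≠ 0 := by
    intro h
    apply h1
    field_simp
    rw [h, mul_zero]
  simp only [qint]
  have e1 : ups ^ (a - m + 1) = ups ^ a / ups ^ m * ups := by
    rw [zpow_add₀ h0, zpow_sub₀ h0, zpow_one]
  have e2 : ups ^ (a - 2 * m) = ups ^ a / (ups ^ m * ups ^ m) := by
    rw [zpow_sub₀ h0, two_mul, zpow_add₀ h0]
  have e3 : ups ^ (m + 1) = ups ^ m * ups := by rw [zpow_add₀ h0, zpow_one]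
  have e4 : ups ^ (a - m) = ups ^ a / ups ^ m := by rw [zpow_sub₀ h0]
  rw [zpow_neg, zpow_neg, zpow_neg, zpow_neg, zpow_neg, e1, e2, e3, e4]
  -- In terms of `x = υ^m`, `y = υ^a` and `q = υ` the claim is an identity of rational functions.
  generalize ups ^ m = x at *
  generalize ups ^ a = y at *
  generalize ups = q at *
  field_simp
  ring

/-! ### Words of simple roots -/

/-- The sum of the simple roots indexed by a word. -/
def wt (l : List ℤ) : Weight := (l.map simpleRoot).sum

@[simp] lemma wt_nil : wt [] = 0 := rfl

@[simp] lemma wt_cons (i : ℤ) (l : List ℤ) : wt (i :: l) = simpleRoot i + wt l := by simp [wt]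

@[simp] lemma wt_append (l m : List ℤ) : wt (l ++ m) = wt l + wt m := by simp [wt]

lemma wt_mem_closure (l : List ℤ) : wt l ∈ AddSubmonoid.closure (Set.range simpleRoot) :=
  AddSubmonoid.list_sum_mem _ fun x hx => by
    obtain ⟨i, -, rfl⟩ := List.mem_map.mp hx
    exact AddSubmonoid.subset_closure ⟨i, rfl⟩

lemma wtLE_iff {mu lam : Weight} : WtLE mu lam ↔ ∃ l, lam = mu + wt l := by
  constructor
  · intro h
    have : ∀ x ∈ AddSubmonoid.closure (Set.range simpleRoot), ∃ l, x = wt l := by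
      intro x hx
      induction hx using AddSubmonoid.closure_induction with
      | mem x hx =>
        obtain ⟨i, rfl⟩ := hx
        exact ⟨[i], by simp⟩
      | zero => exact ⟨[], rfl⟩
      | add x y _ _ hx hy =>
        obtain ⟨l, rfl⟩ := hx
        obtain ⟨m, rfl⟩ := hy
        exact ⟨l ++ m, by simp⟩
    obtain ⟨l, hl⟩ := this _ h
    exact ⟨l, by rw [← hl]; abel⟩
  · rintro ⟨l, rfl⟩
    have : mu + wt l - mu = wt l := by abel
    rw [WtLE, this]
    exact wt_mem_closure l

lemma simpleRoot_apply (i j : ℤ) : simpleRoot j i = delta i j - delta i (j + 1) := by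
  simp [simpleRoot, delta, Pi.single_apply]

lemma simpleRoot_self (i : ℤ) : simpleRoot i i - simpleRoot i (i + 1) = 2 := by
  simp [simpleRoot_apply, delta]

lemma wt_apply (l : List ℤ) (i : ℤ) : wt l i = l.count i - l.count (i - 1) := by
  induction l with
  | nil => simp
  | cons j l ih =>
    rw [wt_cons, Pi.add_apply, ih, simpleRoot_apply, List.count_cons, List.count_cons]
    simp only [delta, beq_iff_eq]
    push_cast
    split_ifs <;> omega

/-- Linear independence of the simple roots: by `wt_apply`, equal weights make the difference of
multiplicities constant in the letter, and it vanishes at a letter occurring in neither word. -/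
lemma perm_of_wt_eq {l m : List ℤ} (h : wt l = wt m) : l.Perm m := by
  set d : ℤ → ℤ := fun i => l.count i - m.count i with hd
  have hstep : ∀ i, d (i - 1) = d i := fun i => by
    have := congrFun h i
    rw [wt_apply, wt_apply] at this
    simp only [hd]
    omega
  have hconst : ∀ i, d i = d 0 := fun i => by
    induction i using Int.induction_on with
    | zero => rfl
    | succ n ih => rw [← ih, ← hstep]; congr 1; ring
    | pred n ih => rw [← ih, hstep]
  obtain ⟨a, ha⟩ := Infinite.exists_notMem_finset (l ++ m).toFinset
  have hda : d a = 0 := by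
    rw [List.mem_toFinset, List.mem_append, not_or] at ha
    simp [hd, List.count_eq_zero_of_not_mem ha.1, List.count_eq_zero_of_not_mem ha.2]
  refine List.perm_iff_count.mpr fun i => ?_
  have h1 := hconst i
  have h2 := hconst a
  simp only [hd] at h1 h2 hda
  omega

lemma wt_eq_zero {l : List ℤ} (h : wt l = 0) : l = [] :=
  List.perm_nil.mp (perm_of_wt_eq (h.trans wt_nil.symm))

lemma WtLE.antisymm {mu lam : Weight} (h1 : WtLE mu lam) (h2 : WtLE lam mu) : mu = lam := by
  obtain ⟨l, hl⟩ := wtLE_iff.mp h1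
  obtain ⟨m, hm⟩ := wtLE_iff.mp h2
  have h0 : wt (l ++ m) = 0 := by
    rw [wt_append]
    have : mu = mu + wt l + wt m := by rw [← hl]; exact hm
    rw [add_assoc] at this
    exact (left_eq_add.mp this)
  have : l = [] := (List.append_eq_nil_iff.mp (wt_eq_zero h0)).1
  rw [hl, this, wt_nil, add_zero]

lemma finite_setOf_wt_eq (nu : Weight) : {l : List ℤ | wt l = nu}.Finite := by
  by_cases h : ∃ m, wt m = nu
  · obtain ⟨m, rfl⟩ := h
    refine (m.permutations.toFinset.finite_toSet).subset fun l hl => ?_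
    simpa using perm_of_wt_eq hl
  · convert Set.finite_empty
    exact Set.eq_empty_of_forall_notMem fun l hl => h ⟨l, hl⟩

/-! ### Relations in the quantum group -/

/-- The generator `K_i⁻¹` of `𝐔(∞)`. -/
def Kinv (i : ℤ) : U := mkU (gen (Gen.Kinv i))

lemma mkU_eq {a b : Free} (h : Rel a b) : mkU a = mkU b := RingQuot.mkAlgHom_rel Base h

lemma K_comm (i j : ℤ) : K i * K j = K j * K i := by
  simpa [K] using mkU_eq (Rel.K_comm i j)

lemma Kinv_mul_K (i : ℤ) : Kinv i * K i = 1 := by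
  simpa [K, Kinv] using mkU_eq (Rel.Kinv_mul_K i)

lemma K_mul_E (i j : ℤ) : K i * E j = ups ^ simpleRoot j i • (E j * K i) := by
  rw [simpleRoot_apply]
  simpa [K, E] using mkU_eq (Rel.K_E i j)

lemma K_mul_F (i j : ℤ) : K i * F j = ups ^ (-simpleRoot j i) • (F j * K i) := by
  rw [simpleRoot_apply, neg_sub]
  simpa [K, F] using mkU_eq (Rel.K_F i j)

lemma F_comm {i j : ℤ} (h : 1 < |i - j|) : F i * F j = F j * F i := by
  simpa [F] using mkU_eq (Rel.F_comm i j h)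

lemma E_mul_F_same (i : ℤ) : E i * F i = F i * E i +
    (ups - ups⁻¹)⁻¹ • (K i * Kinv (i + 1) - K (i + 1) * Kinv i) := by
  have := mkU_eq (Rel.E_F_same i)
  rw [map_sub, map_smul, map_sub, map_mul, map_mul, map_mul, map_mul] at this
  exact (sub_eq_iff_eq_add'.mp this)

lemma E_mul_F_ne {i j : ℤ} (h : i ≠ j) : E i * F j = F j * E i := by
  have := mkU_eq (Rel.E_F_ne i j h)
  rw [map_sub, map_mul, map_mul, map_zero] at this
  exact sub_eq_zero.mp this

lemma F_serre {i j : ℤ} (h : |i - j| = 1) :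
    F i ^ 2 * F j - (ups + ups⁻¹) • (F i * F j * F i) + F j * F i ^ 2 = 0 := by
  have := mkU_eq (Rel.F_serre i j h)
  rw [map_add, map_sub, map_smul, map_zero] at this
  simp only [map_mul, map_pow] at this
  exact this

lemma mkU_surjective : Function.Surjective mkU := RingQuot.mkAlgHom_surjective Base Rel

/-! ### Modules over the quantum group -/

section Modules

variable {M : Type v} [AddCommGroup M] [Module Base M] [Module U M] [IsScalarTower Base U M]

/-- A subspace stable under the generators is stable under `𝐔(∞)`. -/
lemma smul_mem_of_generators (W : Submodule Base M) (hE : ∀ i, ∀ x ∈ W, E i • x ∈ W)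
    (hF : ∀ i, ∀ x ∈ W, F i • x ∈ W) (hK : ∀ i, ∀ x ∈ W, K i • x ∈ W)
    (hKinv : ∀ i, ∀ x ∈ W, Kinv i • x ∈ W) (a : U) {x : M} (hx : x ∈ W) : a • x ∈ W := by
  obtain ⟨a, rfl⟩ := mkU_surjective a
  induction a using FreeAlgebra.induction generalizing x with
  | grade0 r =>
    rw [AlgHom.commutes, algebraMap_smul]
    exact W.smul_mem r hx
  | grade1 g =>
    cases g with
    | E i => exact hE i x hx
    | F i => exact hF i x hx
    | K i => exact hK i x hx
    | Kinv i => exact hKinv i x hx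
  | mul a b ha hb => rw [map_mul, mul_smul]; exact ha (hb hx)
  | add a b ha hb => rw [map_add, add_smul]; exact W.add_mem (ha hx) (hb hx)

lemma Kinv_smul {lam : Weight} {x : M} (hx : x ∈ weightSpace M lam) (i : ℤ) :
    Kinv i • x = ups ^ (-lam i) • x := by
  have h : Kinv i • K i • x = ups ^ lam i • Kinv i • x := by rw [hx i, smul_comm]
  rw [← mul_smul, Kinv_mul_K, one_smul] at h
  rw [zpow_neg, eq_inv_smul_iff₀ (zpow_ne_zero _ ups_ne_zero), ← h]

lemma E_smul_mem {lam : Weight} {x : M} (hx : x ∈ weightSpace M lam) (j : ℤ) :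
    E j • x ∈ weightSpace M (lam + simpleRoot j) := fun i => by
  rw [← mul_smul, K_mul_E, smul_assoc, mul_smul, hx i, smul_comm (E j), smul_smul,
    ← zpow_add₀ ups_ne_zero, Pi.add_apply, add_comm]

lemma F_smul_mem {lam : Weight} {x : M} (hx : x ∈ weightSpace M lam) (j : ℤ) :
    F j • x ∈ weightSpace M (lam - simpleRoot j) := fun i => by
  rw [← mul_smul, K_mul_F, smul_assoc, mul_smul, hx i, smul_comm (F j), smul_smul,
    ← zpow_add₀ ups_ne_zero, Pi.sub_apply, sub_eq_neg_add]

lemma E_F_smul_same {lam : Weight} {x : M} (hx : x ∈ weightSpace M lam) (i : ℤ) :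
    E i • F i • x = F i • E i • x + qint (lam i - lam (i + 1)) • x := by
  have hq : qint (lam i - lam (i + 1)) = (ups - ups⁻¹)⁻¹ *
      (ups ^ (-lam (i + 1)) * ups ^ lam i - ups ^ (-lam i) * ups ^ lam (i + 1)) := by
    rw [qint, ← zpow_add₀ ups_ne_zero, ← zpow_add₀ ups_ne_zero, sub_eq_neg_add (lam i), neg_add,
      neg_neg, add_comm (lam (i + 1)), neg_add_eq_sub, neg_add_eq_sub, sub_eq_neg_add (lam (i + 1))]
  rw [← mul_smul, E_mul_F_same, add_smul, mul_smul, smul_assoc, sub_smul, mul_smul, mul_smul,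
    Kinv_smul hx, Kinv_smul hx, smul_comm (K i), smul_comm (K (i + 1)), hx i, hx (i + 1),
    hq, mul_smul, sub_smul, mul_smul, mul_smul]

omit [Module Base M] [IsScalarTower Base U M] in
lemma E_F_smul_ne {i j : ℤ} (h : i ≠ j) (x : M) : E i • F j • x = F j • E i • x := by
  rw [← mul_smul, E_mul_F_ne h, mul_smul]

lemma wordE_smul_mem {lam : Weight} {x : M} (hx : x ∈ weightSpace M lam) (l : List ℤ) :
    (l.map E).prod • x ∈ weightSpace M (lam + wt l) := by
  induction l with
  | nil => simpa using hx
  | cons i l ih =>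
    rw [List.map_cons, List.prod_cons, mul_smul, wt_cons]
    convert E_smul_mem ih i using 2
    abel

lemma wordF_smul_mem {lam : Weight} {x : M} (hx : x ∈ weightSpace M lam) (l : List ℤ) :
    (l.map F).prod • x ∈ weightSpace M (lam - wt l) := by
  induction l with
  | nil => simpa using hx
  | cons i l ih =>
    rw [List.map_cons, List.prod_cons, mul_smul, wt_cons]
    convert F_smul_mem ih i using 2
    abel

variable (M) in
-- Weight spaces lie in joint generalized eigenspaces of the commuting operators `K_i`, and distinct
-- weights give distinct families of eigenvalues.
lemma iSupIndep_weightSpace : iSupIndep (weightSpace M) := by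
  let f : ℤ → Module.End Base M := fun i => Module.toModuleEnd Base (S := U) M (K i)
  have hcomm : ∀ i j, Commute (f i) (f j) := fun i j => by
    rw [commute_iff_eq, ← map_mul, ← map_mul, K_comm]
  have h := Module.End.independent_iInf_maxGenEigenspace_of_forall_mapsTo f fun i j φ =>
    Module.End.mapsTo_maxGenEigenspace_of_comm (hcomm j i) φ
  have hinj : Function.Injective fun (lam : Weight) (i : ℤ) => ups ^ lam i := fun a b hab =>
    funext fun i => ups_zpow_injective (congrFun hab i)
  refine (h.comp hinj).mono fun lam x hx => ?_
  rw [Function.comp_apply, Submodule.mem_iInf]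
  refine fun i => Module.End.eigenspace_le_maxGenEigenspace ?_
  exact Module.End.mem_eigenspace_iff.mpr (hx i)

lemma isWeightModule_iff : IsWeightModule M ↔ iSup (weightSpace M) = ⊤ := by
  classical
  unfold IsWeightModule
  convert (DirectSum.isInternal_submodule_iff_iSupIndep_and_iSup_eq_top (weightSpace M)).trans
    (and_iff_right (iSupIndep_weightSpace M))

/-- Subspaces of the weight spaces that generate the module are the weight spaces. -/
lemma eq_weightSpace (W : Weight → Submodule Base M) (hW : ∀ lam, W lam ≤ weightSpace M lam)
    (htop : iSup W = ⊤) (lam : Weight) : weightSpace M lam = W lam := by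
  refine le_antisymm (fun x hx => ?_) (hW lam)
  have hx' : x ∈ W lam ⊔ ⨆ (mu) (_ : mu ≠ lam), W mu := by
    rw [← iSup_split_single, htop]
    trivial
  obtain ⟨a, ha, b, hb, rfl⟩ := Submodule.mem_sup.mp hx'
  have hb1 : b ∈ weightSpace M lam := by
    have := Submodule.sub_mem _ hx (hW lam ha)
    rwa [add_sub_cancel_left] at this
  have hb2 : b ∈ ⨆ (mu) (_ : mu ≠ lam), weightSpace M mu :=
    iSup₂_mono (fun mu _ => hW mu) hb
  have : b = 0 := (Submodule.disjoint_def.mp (iSupIndep_weightSpace M lam)) b hb1 hb2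
  rwa [this, add_zero]

/-- Modules in `𝒪` are annihilated locally by long monomials in the `E_i`. -/
lemma IsCatO.isHi (h : IsCatO M) : IsHi M := by
  obtain ⟨hwt, -, s, hs⟩ := h
  refine ⟨hwt, fun x => ?_⟩
  suffices H : ∃ n₀ : ℕ, ∀ l : List ℤ, n₀ ≤ l.length → (l.map E).prod • x = 0 by
    obtain ⟨n, hn⟩ := H
    exact ⟨n + 1, by omega, fun l hl => hn l (by omega)⟩
  have hx : x ∈ iSup (weightSpace M) := by rw [isWeightModule_iff.mp hwt]; trivial
  induction hx using Submodule.iSup_induction' with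
  | mem mu x hx =>
    -- If `μ + wt l ≤ λ`, then `l` extends to a word of weight `λ - μ`; all such words are
    -- permutations of one another, so their common length bounds that of `l`.
    have hbound : ∀ lam ∈ s, ∃ n : ℕ, ∀ l, WtLE (mu + wt l) lam → l.length < n := by
      intro lam _
      by_cases hl : ∃ m, lam = mu + wt m
      · obtain ⟨m, rfl⟩ := hl
        refine ⟨m.length + 1, fun l h => ?_⟩
        obtain ⟨k, hk⟩ := wtLE_iff.mp h
        rw [add_assoc, add_right_inj, ← wt_append] at hk
        rw [(perm_of_wt_eq hk).length_eq, List.length_append]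
        omega
      · refine ⟨0, fun l h => (hl ?_).elim⟩
        obtain ⟨k, hk⟩ := wtLE_iff.mp h
        exact ⟨l ++ k, by rw [hk, wt_append, add_assoc]⟩
    choose! n hn using hbound
    refine ⟨s.sup n, fun l hl => ?_⟩
    by_contra h0
    obtain ⟨lam, hlam, hle⟩ := hs (mu + wt l) fun hbot => h0 <| by
      have := wordE_smul_mem hx l
      rwa [hbot, Submodule.mem_bot] at this
    have h1 := hn lam hlam l hle
    have h2 := Finset.le_sup (f := n) hlam
    omega
  | zero => exact ⟨0, fun l _ => smul_zero _⟩
  | add x y _ _ hx hy =>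
    obtain ⟨m, hm⟩ := hx
    obtain ⟨n, hn⟩ := hy
    refine ⟨max m n, fun l hl => ?_⟩
    rw [smul_add, hm l (le_trans (le_max_left _ _) hl), hn l (le_trans (le_max_right _ _) hl),
      add_zero]

lemma IsHi.E_pow_smul (h : IsHi M) (x : M) : ∃ n₀ : ℕ, ∀ n ≥ n₀, ∀ i, E i ^ n • x = 0 := by
  obtain ⟨n₀, -, hn⟩ := h.2 x
  refine ⟨n₀, fun n hle i => ?_⟩
  simpa using hn (List.replicate n i) (by simpa using hle)

/-! ### Transport along isomorphisms -/

variable {N : Type*} [AddCommGroup N] [Module Base N] [Module U N] [IsScalarTower Base U N]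

lemma map_base_smul (f : M →ₗ[U] N) (c : Base) (x : M) : f (c • x) = c • f x := by
  rw [← algebraMap_smul U c x, map_smul, algebraMap_smul]

/-- A `𝐔(∞)`-linear map as a `ℚ(υ)`-linear map. -/
def baseMap (f : M →ₗ[U] N) : M →ₗ[Base] N :=
  { f with map_smul' := map_base_smul f }

lemma map_mem_weightSpace (f : M →ₗ[U] N) {lam : Weight} {x : M} (hx : x ∈ weightSpace M lam) :
    f x ∈ weightSpace N lam := fun i => by
  rw [← map_smul, hx i, map_base_smul]

lemma IsWeightModule.of_surjective (h : IsWeightModule M) (f : M →ₗ[U] N)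
    (hf : Function.Surjective f) : IsWeightModule N := by
  rw [isWeightModule_iff] at h ⊢
  rw [eq_top_iff]
  have h1 : Submodule.map (baseMap f) (iSup (weightSpace M)) ≤ iSup (weightSpace N) := by
    rw [Submodule.map_iSup]
    refine iSup_mono fun lam => ?_
    rintro _ ⟨x, hx, rfl⟩
    exact map_mem_weightSpace f hx
  refine le_trans ?_ h1
  rintro y -
  obtain ⟨x, rfl⟩ := hf y
  exact ⟨x, by rw [h]; trivial, rfl⟩

lemma IsIntegrable.of_surjective (h : IsIntegrable M) (f : M →ₗ[U] N)
    (hf : Function.Surjective f) : IsIntegrable N := by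
  refine ⟨h.1.of_surjective f hf, fun y i => ?_⟩
  obtain ⟨x, rfl⟩ := hf y
  obtain ⟨n, h1, hn⟩ := h.2 x i
  refine ⟨n, h1, fun m hm => ?_⟩
  rw [← map_smul, ← map_smul, (hn m hm).1, (hn m hm).2, map_zero]
  exact ⟨rfl, rfl⟩

lemma IsCatO.of_equiv (h : IsCatO M) (f : M ≃ₗ[U] N) : IsCatO N := by
  have key : ∀ mu, (weightSpace N mu).map (baseMap f.symm.toLinearMap) = weightSpace M mu := by
    intro mu
    ext x
    refine ⟨?_, fun hx => ⟨f x, map_mem_weightSpace f.toLinearMap hx, f.symm_apply_apply x⟩⟩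
    rintro ⟨y, hy, rfl⟩
    exact map_mem_weightSpace f.symm.toLinearMap hy
  refine ⟨h.1.of_surjective f.toLinearMap f.surjective, fun mu => ?_, ?_⟩
  · have := h.2.1 mu
    have hinj : Function.Injective (baseMap f.symm.toLinearMap) := f.symm.injective
    have e := Submodule.equivMapOfInjective _ hinj (weightSpace N mu)
    rw [key mu] at e
    exact Module.Finite.equiv e.symm
  · obtain ⟨s, hs⟩ := h.2.2
    refine ⟨s, fun mu hmu => hs mu fun hbot => hmu ?_⟩
    rw [eq_bot_iff]
    intro y hy
    have : f.symm y ∈ weightSpace M mu := map_mem_weightSpace f.symm.toLinearMap hy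
    rw [hbot, Submodule.mem_bot] at this
    simpa using this

end Modules

/-! ### Highest weight modules -/

/-- `v` is a vector of weight `λ` annihilated by all the `E_i`. -/
structure IsSingular {M : Type*} [AddCommGroup M] [Module Base M] [Module U M]
    [IsScalarTower Base U M] (lam : Weight) (v : M) : Prop where
  mem : v ∈ weightSpace M lam
  E_smul : ∀ i, E i • v = 0

/-- `v` is a nonzero singular vector of weight `λ` generating `M`. -/
structure IsHighestWeight {M : Type*} [AddCommGroup M] [Module Base M] [Module U M]
    [IsScalarTower Base U M] (lam : Weight) (v : M) : Prop extends IsSingular lam v where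
  ne_zero : v ≠ 0
  span : Submodule.span U {v} = ⊤

section Modules

variable {M : Type v} [AddCommGroup M] [Module Base M] [Module U M] [IsScalarTower Base U M]
variable {N : Type*} [AddCommGroup N] [Module Base N] [Module U N] [IsScalarTower Base U N]
variable {lam mu : Weight} {v w : M}

/-- The span of all monomials in the `F_i` applied to `v`. -/
def wordSpan (v : M) : Submodule Base M :=
  Submodule.span Base (Set.range fun l : List ℤ => (l.map F).prod • v)

omit [IsScalarTower Base U M] in
lemma word_mem_wordSpan (v : M) (l : List ℤ) : (l.map F).prod • v ∈ wordSpan v :=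
  Submodule.subset_span ⟨l, rfl⟩

lemma smul_mem_wordSpan_of_words {v : M} {a : U}
    (h : ∀ l : List ℤ, a • (l.map F).prod • v ∈ wordSpan v) {x : M} (hx : x ∈ wordSpan v) :
    a • x ∈ wordSpan v := by
  induction hx using Submodule.span_induction with
  | mem x hx =>
    obtain ⟨l, rfl⟩ := hx
    exact h l
  | zero => rw [smul_zero]; exact Submodule.zero_mem _
  | add x y _ _ hx hy => rw [smul_add]; exact Submodule.add_mem _ hx hy
  | smul c x _ hx => rw [smul_comm]; exact Submodule.smul_mem _ c hx

lemma F_smul_mem_wordSpan (j : ℤ) {x : M} (hx : x ∈ wordSpan v) : F j • x ∈ wordSpan v := by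
  refine smul_mem_wordSpan_of_words (fun l => ?_) hx
  have := word_mem_wordSpan v (j :: l)
  rwa [List.map_cons, List.prod_cons, mul_smul] at this

/-- Each monomial in the `F_i` applied to `v` is a weight vector. Thus moving `E_i` to the right
past a letter only adds a scalar multiple of a shorter monomial, until `E_i` reaches `v` and kills
it. -/
lemma IsSingular.smul_mem_wordSpan (h : IsSingular lam v) (a : U) {x : M}
    (hx : x ∈ wordSpan v) : a • x ∈ wordSpan v := by
  refine smul_mem_of_generators _ (fun i x => ?_) (fun i x => F_smul_mem_wordSpan i)
    (fun i x => ?_) (fun i x => ?_) a hx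
  · refine smul_mem_wordSpan_of_words fun l => ?_
    induction l with
    | nil => simp [h.E_smul i]
    | cons j l ih =>
      rw [List.map_cons, List.prod_cons, mul_smul]
      by_cases hij : i = j
      · subst hij
        rw [E_F_smul_same (wordF_smul_mem h.mem l)]
        exact Submodule.add_mem _ (F_smul_mem_wordSpan i ih)
          (Submodule.smul_mem _ _ (word_mem_wordSpan v l))
      · rw [E_F_smul_ne hij]
        exact F_smul_mem_wordSpan j ih
  · refine smul_mem_wordSpan_of_words fun l => ?_
    rw [wordF_smul_mem h.mem l i]
    exact Submodule.smul_mem _ _ (word_mem_wordSpan v l)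
  · refine smul_mem_wordSpan_of_words fun l => ?_
    rw [Kinv_smul (wordF_smul_mem h.mem l) i]
    exact Submodule.smul_mem _ _ (word_mem_wordSpan v l)

lemma IsSingular.map (h : IsSingular lam v) (f : M →ₗ[U] N) : IsSingular lam (f v) :=
  ⟨map_mem_weightSpace f h.mem, fun i => by rw [← map_smul, h.E_smul, map_zero]⟩

lemma IsHighestWeight.map (h : IsHighestWeight lam v) (f : M →ₗ[U] N)
    (hf : Function.Surjective f) (h0 : f v ≠ 0) : IsHighestWeight lam (f v) where
  toIsSingular := h.toIsSingular.map f
  ne_zero := h0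
  span := by
    rw [← Set.image_singleton, ← Submodule.map_span, h.span, Submodule.map_top,
      LinearMap.range_eq_top.mpr hf]

lemma IsHighestWeight.wordSpan_eq_top (h : IsHighestWeight lam v) : wordSpan v = ⊤ := by
  rw [eq_top_iff]
  intro x _
  have hx : x ∈ Submodule.span U {v} := by rw [h.span]; trivial
  obtain ⟨a, rfl⟩ := Submodule.mem_span_singleton.mp hx
  refine h.smul_mem_wordSpan a ?_
  simpa using word_mem_wordSpan v []

/-- The span of the monomials in the `F_i` that send a vector of weight `λ` to weight `μ`. -/
def wordSpace (lam : Weight) (v : M) (mu : Weight) : Submodule Base M :=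
  Submodule.span Base ((fun l : List ℤ => (l.map F).prod • v) '' {l | wt l = lam - mu})

lemma IsSingular.wordSpace_le (h : IsSingular lam v) (mu : Weight) :
    wordSpace lam v mu ≤ weightSpace M mu := by
  refine Submodule.span_le.mpr ?_
  rintro _ ⟨l, hl, rfl⟩
  have := wordF_smul_mem h.mem l
  rwa [show wt l = lam - mu from hl, sub_sub_cancel] at this

lemma IsHighestWeight.iSup_wordSpace (h : IsHighestWeight lam v) :
    iSup (wordSpace lam v) = ⊤ := by
  rw [eq_top_iff, ← h.wordSpan_eq_top]
  refine Submodule.span_le.mpr ?_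
  rintro _ ⟨l, rfl⟩
  refine Submodule.mem_iSup_of_mem (lam - wt l) (Submodule.subset_span ⟨l, ?_, rfl⟩)
  exact (sub_sub_cancel _ _).symm

lemma IsHighestWeight.weightSpace_eq (h : IsHighestWeight lam v) (mu : Weight) :
    weightSpace M mu = wordSpace lam v mu :=
  eq_weightSpace _ h.wordSpace_le h.iSup_wordSpace mu

lemma IsHighestWeight.isWeightModule (h : IsHighestWeight lam v) : IsWeightModule M := by
  rw [isWeightModule_iff, funext h.weightSpace_eq]
  exact h.iSup_wordSpace

lemma IsHighestWeight.wtLE (h : IsHighestWeight lam v) (hmu : weightSpace M mu ≠ ⊥) :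
    WtLE mu lam := by
  rw [h.weightSpace_eq] at hmu
  by_contra hle
  apply hmu
  rw [wordSpace, Submodule.span_eq_bot]
  rintro _ ⟨l, hl, -⟩
  exact (hle (wtLE_iff.mpr ⟨l, by rw [show wt l = lam - mu from hl]; abel⟩)).elim

lemma IsHighestWeight.isCatO (h : IsHighestWeight lam v) : IsCatO M := by
  refine ⟨h.isWeightModule, fun mu => ?_, {lam}, fun mu hmu =>
    ⟨lam, Finset.mem_singleton_self _, h.wtLE hmu⟩⟩
  rw [h.weightSpace_eq]
  exact FiniteDimensional.span_of_finite _ ((finite_setOf_wt_eq _).image _)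

lemma weightSpace_ne_bot {x : M} (h0 : x ≠ 0) (hx : x ∈ weightSpace M mu) :
    weightSpace M mu ≠ ⊥ := fun h => h0 (by rwa [h, Submodule.mem_bot] at hx)

/-- Used twice: for the injectivity of `λ ↦ L(λ)`, and to rule out nonzero singular vectors of
another weight in a simple module. -/
lemma IsHighestWeight.weight_unique (h : IsHighestWeight lam v) (h' : IsHighestWeight mu w) :
    lam = mu :=
  WtLE.antisymm (h'.wtLE (weightSpace_ne_bot h.ne_zero h.mem))
    (h.wtLE (weightSpace_ne_bot h'.ne_zero h'.mem))

lemma IsHighestWeight.weightSpace_self_le (h : IsHighestWeight lam v) :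
    weightSpace M lam ≤ Submodule.span Base {v} := by
  rw [h.weightSpace_eq]
  refine Submodule.span_le.mpr ?_
  rintro _ ⟨l, hl, rfl⟩
  have : wt l = 0 := by rw [show wt l = lam - lam from hl, sub_self]
  rw [wt_eq_zero this]
  simp [Submodule.mem_span_singleton_self]

/-- The sum of the weight spaces for the weights different from `λ`. -/
def lowerPart (M : Type v) [AddCommGroup M] [Module Base M] [Module U M] [IsScalarTower Base U M]
    (lam : Weight) : Submodule Base M :=
  ⨆ (mu) (_ : mu ≠ lam), weightSpace M mu

lemma IsHighestWeight.notMem_lowerPart (h : IsHighestWeight lam v) : v ∉ lowerPart M lam :=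
  fun hv => h.ne_zero (Submodule.disjoint_def.mp (iSupIndep_weightSpace M lam) v h.mem hv)

lemma IsHighestWeight.eq_top_iff_mem (h : IsHighestWeight lam v) (P : Submodule U M) :
    P = ⊤ ↔ v ∈ P := by
  rw [eq_top_iff, ← h.span, Submodule.span_singleton_le_iff_mem]

/-- Write `x = c v + b` with `b` in the lower part. In `M ⧸ P` the images of `c v` and `b` cancel,
so independence of the weight spaces there makes both zero; since `v ∉ P`, this gives `c = 0`. -/
lemma IsHighestWeight.mem_lowerPart (h : IsHighestWeight lam v) {P : Submodule U M}
    (hP : P ≠ ⊤) {x : M} (hx : x ∈ P) : x ∈ lowerPart M lam := by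
  have hv : v ∉ P := fun hv => hP ((h.eq_top_iff_mem P).mpr hv)
  have hx' : x ∈ weightSpace M lam ⊔ lowerPart M lam := by
    rw [lowerPart, ← iSup_split_single, isWeightModule_iff.mp h.isWeightModule]
    trivial
  obtain ⟨a, ha, b, hb, rfl⟩ := Submodule.mem_sup.mp hx'
  obtain ⟨c, rfl⟩ := Submodule.mem_span_singleton.mp (h.weightSpace_self_le ha)
  have hb' : P.mkQ b ∈ lowerPart (M ⧸ P) lam := by
    have : (lowerPart M lam).map (baseMap P.mkQ) ≤ lowerPart (M ⧸ P) lam := by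
      simp only [lowerPart, Submodule.map_iSup]
      refine iSup₂_mono fun mu _ => ?_
      rintro _ ⟨y, hy, rfl⟩
      exact map_mem_weightSpace P.mkQ hy
    exact this ⟨b, hb, rfl⟩
  have h0 : P.mkQ (c • v) + P.mkQ b = 0 := by
    rw [← map_add]
    exact (Submodule.Quotient.mk_eq_zero P).mpr hx
  have hb0 : P.mkQ b = 0 := by
    refine Submodule.disjoint_def.mp (iSupIndep_weightSpace (M ⧸ P) lam) _ ?_ hb'
    rw [← neg_eq_of_add_eq_zero_right h0]
    exact Submodule.neg_mem _ (map_mem_weightSpace P.mkQ ha)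
  rw [hb0, add_zero, map_base_smul, smul_eq_zero] at h0
  rcases h0 with rfl | h0
  · rwa [zero_smul, zero_add]
  · exact (hv ((Submodule.Quotient.mk_eq_zero P).mp h0)).elim

lemma IsHighestWeight.sSup_ne_top (h : IsHighestWeight lam v) :
    sSup {P : Submodule U M | P ≠ ⊤} ≠ ⊤ := by
  -- The lower part is only a `ℚ(υ)`-subspace; `Q` is the largest `𝐔(∞)`-submodule inside it. It
  -- contains every proper submodule but not `v`.
  let Q : Submodule U M :=
    { carrier := {x | ∀ a : U, a • x ∈ lowerPart M lam}
      add_mem' := fun {x y} hx hy a => by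
        rw [smul_add]; exact Submodule.add_mem _ (hx a) (hy a)
      zero_mem' := fun a => by rw [smul_zero]; exact Submodule.zero_mem _
      smul_mem' := fun b x hx a => by rw [smul_smul]; exact hx _ }
  have hle : sSup {P : Submodule U M | P ≠ ⊤} ≤ Q :=
    sSup_le fun P hP x hx a => h.mem_lowerPart hP (P.smul_mem a hx)
  intro htop
  have hv : v ∈ Q := hle (by rw [htop]; trivial)
  exact h.notMem_lowerPart (by simpa using hv 1)

lemma IsHighestWeight.isCoatom_sSup (h : IsHighestWeight lam v) :
    IsCoatom (sSup {P : Submodule U M | P ≠ ⊤}) :=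
  ⟨h.sSup_ne_top, fun P hP => by
    by_contra hne
    exact (lt_of_lt_of_le hP (le_sSup hne)).false⟩

lemma IsSingular.isHighestWeight [IsSimpleModule U M] (h : IsSingular lam v) (h0 : v ≠ 0) :
    IsHighestWeight lam v where
  toIsSingular := h
  ne_zero := h0
  span := IsSimpleModule.span_singleton_eq_top U h0

/-- Simple modules in `𝒞^hi` have a highest weight vector. -/
lemma IsHi.exists_isHighestWeight [IsSimpleModule U M] (h : IsHi M) :
    ∃ (lam : Weight) (v : M), IsHighestWeight lam v := by
  have : Nontrivial M := IsSimpleModule.nontrivial U M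
  obtain ⟨mu, hmu⟩ : ∃ mu, weightSpace M mu ≠ ⊥ := by
    by_contra! hall
    have := isWeightModule_iff.mp h.1
    rw [iSup_eq_bot.mpr hall] at this
    exact bot_ne_top this
  obtain ⟨x, hx, hx0⟩ := Submodule.exists_mem_ne_zero_of_ne_bot hmu
  classical
  -- The least such length is positive, since the empty word fixes `x ≠ 0`. A word one letter
  -- shorter that does not kill `x` then yields a vector killed by every `E_i`.
  have hex : ∃ n : ℕ, ∀ l : List ℤ, l.length = n → (l.map E).prod • x = 0 := by
    obtain ⟨n, -, hn⟩ := h.2 x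
    exact ⟨n, fun l hl => hn l hl.ge⟩
  obtain ⟨n, hn⟩ : ∃ n, Nat.find hex = n + 1 := by
    refine Nat.exists_eq_succ_of_ne_zero fun h0 => hx0 ?_
    have := Nat.find_spec hex [] (by rw [h0]; rfl)
    simpa using this
  have hlt := Nat.find_min hex (m := n) (by omega)
  push Not at hlt
  obtain ⟨l, hl, hne⟩ := hlt
  refine ⟨mu + wt l, (l.map E).prod • x, IsSingular.isHighestWeight ⟨wordE_smul_mem hx l,
    fun i => ?_⟩ hne⟩
  have := Nat.find_spec hex (i :: l) (by rw [hn, List.length_cons, hl])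
  rwa [List.map_cons, List.prod_cons, mul_smul] at this

/-! ### Rank one computations -/

lemma F_pow_smul_mem (h : v ∈ weightSpace M lam) (i : ℤ) (n : ℕ) :
    F i ^ n • v ∈ weightSpace M (lam - n • simpleRoot i) := by
  have := wordF_smul_mem h (List.replicate n i)
  simpa [wt] using this

lemma IsSingular.E_F_pow_smul (h : IsSingular lam v) (i : ℤ) (n : ℕ) :
    E i • F i ^ (n + 1) • v =
      (qint (n + 1) * qint (lam i - lam (i + 1) - n)) • F i ^ n • v := by
  induction n with
  | zero =>
    -- At `m = 0` the recursion reads `[a] = [1][a]`, which supplies the factor `[1]`.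
    have := qint_recursion 0 (lam i - lam (i + 1))
    rw [qint_zero, zero_mul, zero_add, mul_zero, sub_zero, zero_add] at this
    rw [zero_add, pow_one, pow_zero, one_smul, E_F_smul_same h.mem, h.E_smul, smul_zero, zero_add,
      Nat.cast_zero, sub_zero, zero_add, ← this]
  | succ n ih =>
    rw [pow_succ', mul_smul, E_F_smul_same (F_pow_smul_mem h.mem i (n + 1)), ih, smul_comm (F i),
      ← mul_smul (F i), ← pow_succ', ← add_smul]
    congr 1
    have := qint_recursion (n + 1) (lam i - lam (i + 1))
    push_cast
    rw [← this]
    have hs := simpleRoot_self i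
    congr 2
    · congr 1; ring
    · rw [Pi.sub_apply, Pi.sub_apply, Pi.smul_apply, Pi.smul_apply, nsmul_eq_mul, nsmul_eq_mul]
      push_cast
      linear_combination (-(n : ℤ) - 1) * hs

lemma IsSingular.E_F_pow_smul_ne (h : IsSingular lam v) {i j : ℤ} (hij : j ≠ i) (n : ℕ) :
    E j • F i ^ n • v = 0 := by
  induction n with
  | zero => rw [pow_zero, one_smul, h.E_smul]
  | succ n ih => rw [pow_succ', mul_smul, E_F_smul_ne hij, ih, smul_zero]

/-- The highest weight of an integrable module is dominant. -/
lemma IsHighestWeight.dominant_of_isIntegrable (h : IsHighestWeight lam v)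
    (hint : IsIntegrable M) : lam ∈ dominant := by
  intro i
  classical
  have hex : ∃ n : ℕ, F i ^ n • v = 0 := by
    obtain ⟨n, -, hn⟩ := hint.2 v i
    exact ⟨n, (hn n le_rfl).2⟩
  obtain ⟨n, hn⟩ : ∃ n, Nat.find hex = n + 1 := by
    refine Nat.exists_eq_succ_of_ne_zero fun h0 => h.ne_zero ?_
    have := Nat.find_spec hex
    rwa [h0, pow_zero, one_smul] at this
  have hne := Nat.find_min hex (m := n) (by omega)
  have h0 := Nat.find_spec hex
  -- Here `F_i^{n+1} v = 0` but `F_i^n v ≠ 0`, so `[n+1][a-n] = 0`; hence `a = n ≥ 0`.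
  have hE := h.E_F_pow_smul i n
  rw [hn] at h0
  rw [h0, smul_zero, eq_comm, smul_eq_zero, or_iff_left hne, mul_eq_zero, qint_eq_zero_iff,
    qint_eq_zero_iff] at hE
  omega

/-- For `n = λ_i - λ_{i+1}` the factor `[a-n]` vanishes, so `F_i^{n+1} v` is singular. Were it
nonzero, the simple module would have two different highest weights. -/
lemma IsHighestWeight.F_pow_smul_eq_zero [IsSimpleModule U M] (h : IsHighestWeight lam v)
    (hlam : lam ∈ dominant) (i : ℤ) : ∃ n : ℕ, F i ^ n • v = 0 := by
  obtain ⟨n, hn⟩ := Int.eq_ofNat_of_zero_le (sub_nonneg.mpr (hlam i))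
  refine ⟨n + 1, ?_⟩
  by_contra h0
  have hs : IsSingular (lam - (n + 1) • simpleRoot i) (F i ^ (n + 1) • v) := by
    refine ⟨F_pow_smul_mem h.mem i (n + 1), fun j => ?_⟩
    by_cases hji : j = i
    · subst hji
      rw [h.E_F_pow_smul, hn, sub_self, qint_zero, mul_zero, zero_smul]
    · exact h.E_F_pow_smul_ne hji _
  have heq := congrFun (h.weight_unique (hs.isHighestWeight h0)) i
  have h1 : simpleRoot i i = 1 := by simp [simpleRoot_apply, delta]
  rw [Pi.sub_apply, Pi.smul_apply, h1, nsmul_eq_mul] at heq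
  push_cast at heq
  omega

/-- This carries local nilpotency of `F_i` from `x` to `F_j x`, at the cost of one more power. For
neighbouring indices the Serre relation puts `F_i^2 F_j` in the left ideal generated by `F_i`. -/
lemma exists_F_pow_mul_F (i j : ℤ) : ∀ n : ℕ, ∃ a : U, F i ^ (n + 1) * F j = a * F i ^ n := by
  rcases lt_trichotomy |i - j| 1 with hij | hij | hij
  · have : i = j := by rw [Int.abs_lt_one_iff] at hij; omega
    subst this
    exact fun n => ⟨F i ^ 2, by rw [← pow_succ, ← pow_add]; congr 1; omega⟩
  · have hserre : F i ^ 2 * F j = ((ups + ups⁻¹) • (F i * F j) - F j * F i) * F i := by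
      have := F_serre hij
      rw [sub_mul, smul_mul_assoc, mul_assoc (F j), ← sq, eq_sub_iff_add_eq, ← sub_eq_zero]
      rw [← this]
      abel
    intro n
    -- Multiplying the quadratic Serre relation by a power of `F_i` expresses exponent `n + 3`
    -- through exponents `n + 2` and `n + 1`.
    induction n using Nat.twoStepInduction with
    | zero => exact ⟨F i * F j, by simp⟩
    | one => exact ⟨_, by rw [pow_one]; exact hserre⟩
    | more n ih1 ih2 =>
      obtain ⟨a, ha⟩ := ih1
      obtain ⟨b, hb⟩ := ih2
      refine ⟨(ups + ups⁻¹) • b - a, ?_⟩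
      calc F i ^ (n + 2 + 1) * F j = F i ^ (n + 1) * (F i ^ 2 * F j) := by
            rw [← mul_assoc, ← pow_add]
        _ = (ups + ups⁻¹) • (F i ^ (n + 1 + 1) * F j * F i) - F i ^ (n + 1) * F j * F i ^ 2 := by
            rw [hserre, pow_succ (F i) (n + 1), sub_mul, mul_sub, smul_mul_assoc, mul_smul_comm]
            simp only [mul_assoc, sq]
        _ = ((ups + ups⁻¹) • b - a) * F i ^ (n + 2) := by
            rw [hb, ha, sub_mul, smul_mul_assoc, mul_assoc, mul_assoc, ← pow_succ, ← pow_add]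
  · intro n
    refine ⟨F i * F j, ?_⟩
    have hc : Commute (F i) (F j) := F_comm hij
    rw [pow_succ', mul_assoc, mul_assoc, (hc.pow_left n).eq]

/-- The integrability criterion for simple highest weight modules. -/
lemma IsHighestWeight.isIntegrable [IsSimpleModule U M] (h : IsHighestWeight lam v)
    (hlam : lam ∈ dominant) : IsIntegrable M := by
  refine ⟨h.isWeightModule, fun x i => ?_⟩
  -- The vectors on which `F_i` is nilpotent form a subspace, so monomials applied to `v` suffice.
  let P : Submodule Base M :=
    { carrier := {x | ∃ n : ℕ, F i ^ n • x = 0}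
      zero_mem' := ⟨0, smul_zero _⟩
      add_mem' := by
        rintro x y ⟨m, hm⟩ ⟨n, hn⟩
        refine ⟨m + n, ?_⟩
        rw [smul_add, pow_add, mul_smul _ _ y, hn, smul_zero, add_zero, ← pow_add, add_comm,
          pow_add, mul_smul, hm, smul_zero]
      smul_mem' := by
        rintro c x ⟨n, hn⟩
        exact ⟨n, by rw [smul_comm, hn, smul_zero]⟩ }
  have hP : ∀ l : List ℤ, (l.map F).prod • v ∈ P := by
    intro l
    induction l with
    | nil =>
      rw [List.map_nil, List.prod_nil, one_smul]
      exact h.F_pow_smul_eq_zero hlam i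
    | cons j l ih =>
      obtain ⟨n, hn⟩ := ih
      obtain ⟨a, ha⟩ := exists_F_pow_mul_F i j n
      refine ⟨n + 1, ?_⟩
      rw [List.map_cons, List.prod_cons, mul_smul, ← mul_smul, ha, mul_smul, hn, smul_zero]
  have hx : x ∈ P := by
    have : wordSpan v ≤ P := Submodule.span_le.mpr (by rintro _ ⟨l, rfl⟩; exact hP l)
    exact this (by rw [h.wordSpan_eq_top]; trivial)
  obtain ⟨m, hm⟩ := hx
  obtain ⟨n, hn⟩ := h.isCatO.isHi.E_pow_smul x
  refine ⟨max m n + 1, by omega, fun k hk => ⟨hn k (by omega) i, ?_⟩⟩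
  obtain ⟨d, rfl⟩ := Nat.exists_eq_add_of_le (show m ≤ k by omega)
  rw [add_comm, pow_add, mul_smul, hm, smul_zero]

end Modules

/-! ### Quantum Serre elements in an abstract algebra -/

section Abstract

variable {A : Type*} [Ring A] [Algebra Base A]

/-- `k` and `x` commute up to the scalar `s`. -/
def QComm (s : Base) (k x : A) : Prop := k * x = s • (x * k)

lemma QComm.mul {s t : Base} {k x y : A} (hx : QComm s k x) (hy : QComm t k y) :
    QComm (s * t) k (x * y) := by
  unfold QComm at *
  rw [← mul_assoc, hx, smul_mul_assoc, mul_assoc, hy, mul_smul_comm, smul_smul, mul_assoc]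

lemma QComm.mul_left {s t : Base} {k l x : A} (hk : QComm s k x) (hl : QComm t l x) :
    QComm (s * t) (k * l) x := by
  unfold QComm at *
  rw [mul_assoc, hl, mul_smul_comm, ← mul_assoc, hk, smul_mul_assoc, smul_smul, mul_assoc,
    mul_comm]

lemma QComm.add {s : Base} {k x y : A} (hx : QComm s k x) (hy : QComm s k y) :
    QComm s k (x + y) := by
  unfold QComm at *
  rw [mul_add, hx, hy, add_mul, smul_add]

lemma QComm.sub {s : Base} {k x y : A} (hx : QComm s k x) (hy : QComm s k y) :
    QComm s k (x - y) := by
  unfold QComm at *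
  rw [mul_sub, hx, hy, sub_mul, smul_sub]

lemma QComm.smul {s : Base} {k x : A} (c : Base) (hx : QComm s k x) : QComm s k (c • x) := by
  unfold QComm at *
  rw [mul_smul_comm, hx, smul_mul_assoc, smul_comm]

lemma QComm.inv {s : Base} (hs : s ≠ 0) {k k' x : A} (h : k * k' = 1) (h' : k' * k = 1)
    (hx : QComm s k x) : QComm s⁻¹ k' x := by
  unfold QComm at *
  have : k' * (k * x) * k' = s • (k' * x) := by
    rw [hx, mul_smul_comm, smul_mul_assoc, mul_assoc, mul_assoc, h, mul_one]
  rw [← mul_assoc, h', one_mul] at this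
  rw [this, smul_smul, inv_mul_cancel₀ hs, one_smul]

/-- The difference of the two sides of the relations between the `e_i` alone. -/
inductive SerreElement (e : ℤ → A) : A → Prop
  | comm (i j : ℤ) (h : 1 < |i - j|) : SerreElement e (e i * e j - e j * e i)
  | serre (i j : ℤ) (h : |i - j| = 1) :
      SerreElement e (e i ^ 2 * e j - (ups + ups⁻¹) • (e i * e j * e i) + e j * e i ^ 2)

/-- All terms of a Serre element contain the same letters, hence acquire the same scalar. -/
lemma SerreElement.exists_qcomm {f : ℤ → A} {k x : A} {s : ℤ → Base}
    (hk : ∀ j, QComm (s j) k (f j)) (hx : SerreElement f x) : ∃ t, QComm t k x := by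
  cases hx with
  | comm i j hij =>
    refine ⟨_, ((hk i).mul (hk j)).sub ?_⟩
    rw [mul_comm]
    exact (hk j).mul (hk i)
  | serre i j hij =>
    simp only [sq]
    refine ⟨_, ((((hk i).mul (hk i)).mul (hk j)).sub (QComm.smul _ ?_)).add ?_⟩
    · rw [mul_right_comm]
      exact ((hk i).mul (hk j)).mul (hk i)
    · rw [mul_comm]
      exact (hk j).mul ((hk i).mul (hk i))

/-- The relations of `𝐔(∞)` other than those between the `E_i` alone and the `F_i` alone. -/
structure WeakRel (e f k k' : ℤ → A) : Prop where
  k_comm (i j : ℤ) : k i * k j = k j * k i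
  k_k' (i : ℤ) : k i * k' i = 1
  k'_k (i : ℤ) : k' i * k i = 1
  k_e (i j : ℤ) : QComm (ups ^ simpleRoot j i) (k i) (e j)
  k_f (i j : ℤ) : QComm (ups ^ (-simpleRoot j i)) (k i) (f j)
  e_f_same (i : ℤ) : e i * f i - f i * e i =
    (ups - ups⁻¹)⁻¹ • (k i * k' (i + 1) - k (i + 1) * k' i)
  e_f_ne (i j : ℤ) (h : i ≠ j) : Commute (e i) (f j)

namespace WeakRel

variable {e f k k' : ℤ → A}

lemma k'_e (h : WeakRel e f k k') (i j : ℤ) : QComm (ups ^ (-simpleRoot j i)) (k' i) (e j) := by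
  rw [zpow_neg]
  exact (h.k_e i j).inv (zpow_ne_zero _ ups_ne_zero) (h.k_k' i) (h.k'_k i)

lemma k'_f (h : WeakRel e f k k') (i j : ℤ) : QComm (ups ^ simpleRoot j i) (k' i) (f j) := by
  have := (h.k_f i j).inv (zpow_ne_zero _ ups_ne_zero) (h.k_k' i) (h.k'_k i)
  rwa [← zpow_neg, neg_neg] at this

lemma commute_k_k' (h : WeakRel e f k k') (i j : ℤ) : Commute (k i) (k' j) := by
  have h1 : QComm 1 (k j) (k i) := by rw [QComm, one_smul, h.k_comm]
  have h2 := h1.inv one_ne_zero (h.k_k' j) (h.k'_k j)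
  rw [QComm, inv_one, one_smul] at h2
  exact h2.symm

lemma commute_k'_k' (h : WeakRel e f k k') (i j : ℤ) : Commute (k' i) (k' j) := by
  have h1 : QComm 1 (k i) (k' j) := by rw [QComm, one_smul, h.commute_k_k']
  have h2 := h1.inv one_ne_zero (h.k_k' i) (h.k'_k i)
  rwa [QComm, inv_one, one_smul] at h2

/-- The symmetry exchanging the `e_i` with the `f_i`. -/
lemma symm (h : WeakRel e f k k') : WeakRel f e k' k where
  k_comm := h.commute_k'_k'
  k_k' := h.k'_k
  k'_k := h.k_k'
  k_e := h.k'_f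
  k_f := h.k'_e
  e_f_same i := by
    rw [← neg_sub, h.e_f_same, ← smul_neg, neg_sub, h.commute_k_k' (i + 1) i,
      h.commute_k_k' i (i + 1)]
  e_f_ne i j hij := (h.e_f_ne j i hij.symm).symm

/-- The element `k_i k_{i+1}⁻¹` commutes with `e_j` up to a power of `υ`. -/
lemma kk'_e (h : WeakRel e f k k') (i j : ℤ) :
    QComm (ups ^ (simpleRoot j i - simpleRoot j (i + 1))) (k i * k' (i + 1)) (e j) := by
  rw [sub_eq_add_neg, zpow_add₀ ups_ne_zero]
  exact (h.k_e i j).mul_left (h.k'_e (i + 1) j)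

lemma k'k_e (h : WeakRel e f k k') (i j : ℤ) :
    QComm (ups ^ (-(simpleRoot j i - simpleRoot j (i + 1)))) (k (i + 1) * k' i) (e j) := by
  rw [neg_sub, sub_eq_add_neg, zpow_add₀ ups_ne_zero]
  exact (h.k_e (i + 1) j).mul_left (h.k'_e i j)

end WeakRel

section Identities

variable {𝕜 B : Type*} [Field 𝕜] [Ring B] [Algebra 𝕜 B] {e e' f x y : B} {s c d : 𝕜}

/-- The Serre expression with `e'` replaced by `x`: moving `x` to the right leaves the factor `1 - d
s + s^2 = 0`. -/
lemma serre_identity_right (hs : s ^ 2 + 1 = d * s) (hx : x * e = s • (e * x)) :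
    e ^ 2 * x - d • (e * x * e) + x * e ^ 2 = 0 := by
  have h1 : e * x * e = s • (e ^ 2 * x) := by
    rw [mul_assoc, hx, mul_smul_comm, sq, mul_assoc]
  have h2 : x * e ^ 2 = s ^ 2 • (e ^ 2 * x) := by
    rw [sq e, ← mul_assoc, hx, smul_mul_assoc, h1, smul_smul, sq s, sq e]
  rw [h1, h2, smul_smul, ← hs]
  module

/-- The Serre expression with one of its two factors `e` replaced by `x`, summed over both choices.
The exponents `2` and `-1` of `s` are the Cartan integers. -/
lemma serre_identity_left (hs0 : s ≠ 0) (hs : s ^ 2 + 1 = d * s) (hx : x * e = s ^ 2 • (e * x))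
    (hx' : x * e' = s⁻¹ • (e' * x)) :
    (e * x + x * e) * e' - d • (x * e' * e + e * e' * x) + e' * (e * x + x * e) = 0 := by
  have h1 : e * x * e' = s⁻¹ • (e * e' * x) := by
    rw [mul_assoc, hx', mul_smul_comm, mul_assoc]
  have h2 : x * e' * e = s • (e' * e * x) := by
    rw [hx', smul_mul_assoc, mul_assoc, hx, mul_smul_comm, smul_smul, mul_assoc]
    congr 1
    field_simp
  have hs' : d = s + s⁻¹ := by
    field_simp
    linear_combination -hs
  have h3 : s ^ 2 * s⁻¹ = s := by field_simp
  rw [h2, hx, add_mul, smul_mul_assoc, h1, mul_add, mul_smul_comm, ← mul_assoc, smul_smul, h3,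
    smul_add, smul_smul, ← hs, hs']
  module

/-- Commuting a Serre element with `f` when `[e, f]` is a multiple of `x - y`. -/
lemma serre_commute_left (hs : e * f = f * e + c • (x - y)) (hf : e' * f = f * e')
    (hx : (e * x + x * e) * e' - d • (x * e' * e + e * e' * x) + e' * (e * x + x * e) = 0)
    (hy : (e * y + y * e) * e' - d • (y * e' * e + e * e' * y) + e' * (e * y + y * e) = 0) :
    Commute (e ^ 2 * e' - d • (e * e' * e) + e' * e ^ 2) f := by
  have h1 : e ^ 2 * f = f * e ^ 2 + c • (e * x + x * e - (e * y + y * e)) := by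
    rw [sq, mul_assoc, hs, mul_add, ← mul_assoc, hs, add_mul, mul_smul_comm, smul_mul_assoc,
      mul_assoc, mul_sub, sub_mul]
    module
  have h2 : e * e' * e * f = f * (e * e' * e) +
      c • (x * e' * e + e * e' * x - (y * e' * e + e * e' * y)) := by
    rw [mul_assoc, hs, mul_add, ← mul_assoc, mul_assoc e e' f, hf, ← mul_assoc, hs]
    simp only [add_mul, smul_mul_assoc, sub_mul, mul_smul_comm, mul_sub, mul_assoc]
    module
  have h3 : e ^ 2 * e' * f = f * (e ^ 2 * e') + c • ((e * x + x * e) * e' -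
      (e * y + y * e) * e') := by
    rw [mul_assoc, hf, ← mul_assoc, h1, add_mul, smul_mul_assoc, sub_mul, mul_assoc]
  have h4 : e' * e ^ 2 * f = f * (e' * e ^ 2) +
      c • (e' * (e * x + x * e) - e' * (e * y + y * e)) := by
    rw [mul_assoc, h1, mul_add, ← mul_assoc, hf, mul_smul_comm, mul_sub, mul_assoc]
  rw [commute_iff_eq, add_mul, sub_mul, smul_mul_assoc, h2, h3, h4, mul_add f, mul_sub f,
    mul_smul_comm]
  linear_combination (norm := module) c • hx - c • hy

/-- Commutation with `f` is a derivation that kills `e` and replaces `e'` by `c (x - y)`, so the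
bracket is a combination of `hx` and `hy`. -/
lemma serre_commute_right (hs : e' * f = f * e' + c • (x - y)) (hf : e * f = f * e)
    (hx : e ^ 2 * x - d • (e * x * e) + x * e ^ 2 = 0)
    (hy : e ^ 2 * y - d • (e * y * e) + y * e ^ 2 = 0) :
    Commute (e ^ 2 * e' - d • (e * e' * e) + e' * e ^ 2) f := by
  have h1 : e ^ 2 * f = f * e ^ 2 := (Commute.pow_left hf 2)
  have h2 : e * e' * e * f = f * (e * e' * e) + c • (e * x * e - e * y * e) := by
    rw [mul_assoc, hf, ← mul_assoc, mul_assoc e, hs, mul_add, ← mul_assoc, hf]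
    simp only [add_mul, smul_mul_assoc, sub_mul, mul_smul_comm, mul_sub, mul_assoc]
  have h3 : e ^ 2 * e' * f = f * (e ^ 2 * e') + c • (e ^ 2 * x - e ^ 2 * y) := by
    rw [mul_assoc, hs, mul_add, ← mul_assoc, h1, mul_smul_comm, mul_sub, mul_assoc]
  have h4 : e' * e ^ 2 * f = f * (e' * e ^ 2) + c • (x * e ^ 2 - y * e ^ 2) := by
    rw [mul_assoc, h1, ← mul_assoc, hs, add_mul, smul_mul_assoc, sub_mul, mul_assoc]
  rw [commute_iff_eq, add_mul, sub_mul, smul_mul_assoc, h2, h3, h4, mul_add f, mul_sub f,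
    mul_smul_comm]
  linear_combination (norm := module) c • hx - c • hy

end Identities

lemma zpow_serre_scalar {a : ℤ} (ha : a = 1 ∨ a = -1) :
    (ups ^ a) ^ 2 + 1 = (ups + ups⁻¹) * ups ^ a := by
  have := ups_ne_zero
  rcases ha with rfl | rfl
  · rw [zpow_one]; field_simp
  · rw [zpow_neg_one]; field_simp; ring

lemma simpleRoot_sub_of_abs {i j : ℤ} (h : |i - j| = 1) :
    simpleRoot j i - simpleRoot j (i + 1) = -1 := by
  simp only [simpleRoot_apply, delta]
  rcases (abs_eq zero_le_one).mp h with h | h <;> split_ifs <;> omega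

lemma simpleRoot_sub_of_lt_abs {i j : ℤ} (h : 1 < |i - j|) :
    simpleRoot j i - simpleRoot j (i + 1) = 0 := by
  simp only [simpleRoot_apply, delta]
  rcases lt_abs.mp h with h | h <;> split_ifs <;> omega

/-- The Serre elements in the `e_i` commute with the `f_i`. -/
lemma WeakRel.commute_serreElement {e f k k' : ℤ → A} (h : WeakRel e f k k') {x : A}
    (hx : SerreElement e x) (m : ℤ) : Commute x (f m) := by
  have hsame : ∀ i, e i * f i = f i * e i +
      (ups - ups⁻¹)⁻¹ • (k i * k' (i + 1) - k (i + 1) * k' i) := fun i => by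
    rw [← h.e_f_same]; abel
  cases hx with
  | comm i j hij =>
    -- Bracketing with `f_i` replaces `e_i` by a combination of `k_i k_{i+1}⁻¹` and its inverse,
    -- which commute with `e_j` because the Cartan integer is zero.
    have key : ∀ i j, 1 < |i - j| → Commute (e i * e j - e j * e i) (f i) := by
      intro i j hij
      have hne : i ≠ j := by rintro rfl; simp at hij
      have h1 := h.kk'_e i j
      have h2 := h.k'k_e i j
      rw [simpleRoot_sub_of_lt_abs hij, QComm] at h1 h2
      rw [zpow_zero, one_smul] at h1
      rw [neg_zero, zpow_zero, one_smul] at h2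
      have hj := h.e_f_ne j i hne.symm
      generalize hX : k i * k' (i + 1) = X at *
      generalize hY : k (i + 1) * k' i = Y at *
      have hs := hsame i
      rw [hX, hY] at hs
      rw [commute_iff_eq, sub_mul, mul_sub, mul_assoc, hj.eq, ← mul_assoc, hs, mul_assoc (e j), hs]
      rw [mul_add, add_mul, ← mul_assoc (e j), hj.eq, mul_smul_comm, smul_mul_assoc, sub_mul,
        mul_sub, h1, h2]
      simp only [mul_assoc]
      abel
    have hne : i ≠ j := by rintro rfl; simp at hij
    by_cases hi : i = m
    · subst hi; exact key i j hij
    by_cases hj : j = m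
    · subst hj
      rw [← neg_sub]
      exact (key j i (by rwa [abs_sub_comm])).neg_left
    · have h1 := h.e_f_ne i m hi
      have h2 := h.e_f_ne j m hj
      exact (h1.mul_left h2).sub_left (h2.mul_left h1)
  | serre i j hij =>
    have hne : i ≠ j := by rintro rfl; simp at hij
    by_cases hi : i = m
    · subst hi
      have hj := h.e_f_ne j i hne.symm
      have h1 := h.kk'_e i i
      have h1' := h.kk'_e i j
      have h2 := h.k'k_e i i
      have h2' := h.k'k_e i j
      rw [simpleRoot_self] at h1 h2
      rw [simpleRoot_sub_of_abs hij] at h1' h2'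
      -- The scalar is `υ` for `k_i k_{i+1}⁻¹` and `υ⁻¹` for its inverse; both are roots of `t^2 -
      -- (υ + υ⁻¹) t + 1`.
      have i1 := serre_identity_left (x := k i * k' (i + 1)) (e' := e j) (s := ups ^ (1 : ℤ))
        (zpow_ne_zero _ ups_ne_zero) (zpow_serre_scalar (Or.inl rfl))
        (by rw [← zpow_natCast, ← zpow_mul]; exact h1)
        (by rw [← zpow_neg]; exact h1')
      have i2 := serre_identity_left (x := k (i + 1) * k' i) (e' := e j) (s := ups ^ (-1 : ℤ))
        (zpow_ne_zero _ ups_ne_zero) (zpow_serre_scalar (Or.inr rfl))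
        (by rw [← zpow_natCast, ← zpow_mul]; exact h2)
        (by rw [← zpow_neg]; exact h2')
      exact serre_commute_left (hsame i) hj i1 i2
    by_cases hj : j = m
    · subst hj
      have h1 := h.kk'_e j i
      have h2 := h.k'k_e j i
      rw [simpleRoot_sub_of_abs (by rwa [abs_sub_comm])] at h1 h2
      have i1 := serre_identity_right (zpow_serre_scalar (Or.inr rfl)) h1
      have i2 := serre_identity_right (zpow_serre_scalar (Or.inl rfl)) h2
      exact serre_commute_right (hsame j) (h.e_f_ne i j hi) i1 i2
    · have h1 := h.e_f_ne i m hi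
      have h2 := h.e_f_ne j m hj
      exact (((h1.pow_left 2).mul_left h2).sub_left
        (((h1.mul_left h2).mul_left h1).smul_left _)).add_left (h2.mul_left (h1.pow_left 2))

end Abstract

/-! ### The free highest weight module without Serre relations -/

/-- The vector space with basis the words in the `F_i`. -/
abbrev WordModule : Type := List ℤ →₀ Base

namespace WordModule

/-- The basis vector of a word. -/
abbrev vec (l : List ℤ) : WordModule := Finsupp.single l 1

/-- The endomorphism with prescribed values on words. -/
def ofWords (φ : List ℤ → WordModule) : Module.End Base WordModule :=
  Finsupp.linearCombination Base φ

@[simp] lemma ofWords_vec (φ : List ℤ → WordModule) (l : List ℤ) : ofWords φ (vec l) = φ l := by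
  simp [ofWords]

lemma ext_words {W : Type*} [AddCommGroup W] [Module Base W] {a b : WordModule →ₗ[Base] W}
    (h : ∀ l, a (vec l) = b (vec l)) : a = b :=
  Finsupp.lhom_ext' fun l => LinearMap.ext_ring (h l)

/-- `F_i` adds a letter. -/
def opF (i : ℤ) : Module.End Base WordModule := ofWords fun l => vec (i :: l)

/-- `K_i` acts on words by their weights. -/
def opK (lam : Weight) (i : ℤ) : Module.End Base WordModule :=
  ofWords fun l => ups ^ (lam - wt l) i • vec l

/-- `K_i⁻¹` acts on words by their weights. -/
def opKinv (lam : Weight) (i : ℤ) : Module.End Base WordModule :=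
  ofWords fun l => ups ^ (-(lam - wt l) i) • vec l

/-- The value of `E_i` on words. -/
def valE (lam : Weight) (i : ℤ) : List ℤ → WordModule
  | [] => 0
  | j :: l => opF j (valE lam i l) +
      if i = j then qint ((lam - wt l) i - (lam - wt l) (i + 1)) • vec l else 0

/-- The action of `E_i`. -/
def opE (lam : Weight) (i : ℤ) : Module.End Base WordModule := ofWords (valE lam i)

@[simp] lemma opF_vec (i : ℤ) (l : List ℤ) : opF i (vec l) = vec (i :: l) := ofWords_vec _ _

@[simp] lemma opK_vec (lam : Weight) (i : ℤ) (l : List ℤ) :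
    opK lam i (vec l) = ups ^ (lam - wt l) i • vec l := ofWords_vec _ _

@[simp] lemma opKinv_vec (lam : Weight) (i : ℤ) (l : List ℤ) :
    opKinv lam i (vec l) = ups ^ (-(lam - wt l) i) • vec l := ofWords_vec _ _

@[simp] lemma opE_nil (lam : Weight) (i : ℤ) : opE lam i (vec []) = 0 := ofWords_vec _ _

lemma opE_cons (lam : Weight) (i j : ℤ) (l : List ℤ) :
    opE lam i (vec (j :: l)) = opF j (opE lam i (vec l)) +
      if i = j then qint ((lam - wt l) i - (lam - wt l) (i + 1)) • vec l else 0 := by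
  rw [opE, ofWords_vec, ofWords_vec, valE]

variable (lam : Weight)

lemma opK_opF (i j : ℤ) : QComm (ups ^ (-simpleRoot j i)) (opK lam i) (opF j) := by
  refine ext_words fun l => ?_
  rw [Module.End.mul_apply, opF_vec, opK_vec, LinearMap.smul_apply, Module.End.mul_apply, opK_vec,
    map_smul, opF_vec, smul_smul, ← zpow_add₀ ups_ne_zero]
  congr 2
  simp only [Pi.sub_apply, wt_cons, Pi.add_apply]
  ring

lemma opK_opE (i j : ℤ) : QComm (ups ^ simpleRoot j i) (opK lam i) (opE lam j) := by
  refine ext_words fun l => ?_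
  rw [LinearMap.smul_apply, Module.End.mul_apply, Module.End.mul_apply, opK_vec, map_smul,
    smul_smul, ← zpow_add₀ ups_ne_zero]
  induction l with
  | nil => simp
  | cons m l ih =>
    have hF : ∀ x, opK lam i (opF m x) = ups ^ (-simpleRoot m i) • opF m (opK lam i x) :=
      fun x => LinearMap.congr_fun (opK_opF lam i m) x
    rw [opE_cons, map_add, hF, ih, map_smul, smul_smul, ← zpow_add₀ ups_ne_zero, smul_add]
    congr 1
    · congr 2
      simp only [Pi.sub_apply, wt_cons, Pi.add_apply]
      ring
    · split_ifs with hjm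
      · subst hjm
        rw [map_smul, opK_vec, smul_comm]
        congr 2
        simp only [Pi.sub_apply, wt_cons, Pi.add_apply]
        ring_nf
      · rw [map_zero, smul_zero]

/-- The recursion defining `valE` is the commutator rule itself, so the relations between `e_i` and
`f_j` hold by construction. -/
lemma weakRel : WeakRel (opE lam) opF (opK lam) (opKinv lam) where
  k_comm i j := ext_words fun l => by
    simp only [Module.End.mul_apply, opK_vec, map_smul]
    rw [smul_comm]
  k_k' i := ext_words fun l => by
    rw [Module.End.mul_apply, opKinv_vec, map_smul, opK_vec, smul_smul, ← zpow_add₀ ups_ne_zero,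
      neg_add_cancel, zpow_zero, one_smul, Module.End.one_apply]
  k'_k i := ext_words fun l => by
    rw [Module.End.mul_apply, opK_vec, map_smul, opKinv_vec, smul_smul, ← zpow_add₀ ups_ne_zero,
      add_neg_cancel, zpow_zero, one_smul, Module.End.one_apply]
  k_e := opK_opE lam
  k_f := opK_opF lam
  e_f_same i := ext_words fun l => by
    rw [LinearMap.sub_apply, Module.End.mul_apply, Module.End.mul_apply, opF_vec, opE_cons,
      if_pos rfl, add_sub_cancel_left, LinearMap.smul_apply, LinearMap.sub_apply,
      Module.End.mul_apply, Module.End.mul_apply, opKinv_vec, opKinv_vec, map_smul, map_smul,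
      opK_vec, opK_vec, smul_smul, smul_smul, ← zpow_add₀ ups_ne_zero, ← zpow_add₀ ups_ne_zero,
      ← sub_smul, smul_smul, qint, neg_sub, neg_add_eq_sub, neg_add_eq_sub]
  e_f_ne i j hij := ext_words fun l => by
    rw [Module.End.mul_apply, Module.End.mul_apply, opF_vec, opE_cons, if_neg hij, add_zero]

/-- Such an operator kills the empty word and commutes with every `opF m`, and these build all words
from the empty one. -/
lemma eq_zero_of_serreElement_opE {x : Module.End Base WordModule}
    (hx : SerreElement (opE lam) x) : x = 0 := by
  refine ext_words fun l => ?_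
  rw [LinearMap.zero_apply]
  induction l with
  | nil => cases hx <;> simp [sq]
  | cons m l ih =>
    have := LinearMap.congr_fun ((weakRel lam).commute_serreElement hx m) (vec l)
    rw [Module.End.mul_apply, Module.End.mul_apply, opF_vec, ih, map_zero] at this
    exact this

/-- The subspace generated by the Serre elements in the `F_i`. -/
def serreSubspace : Submodule Base WordModule :=
  Submodule.span Base {y | ∃ (w : List ℤ) (x : Module.End Base WordModule) (z : WordModule),
    SerreElement opF x ∧ y = (w.map opF).prod (x z)}

lemma word_mem_serreSubspace (w : List ℤ) {x : Module.End Base WordModule}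
    (hx : SerreElement opF x) (z : WordModule) : (w.map opF).prod (x z) ∈ serreSubspace :=
  Submodule.subset_span ⟨w, x, z, hx, rfl⟩

lemma apply_mem_serreSubspace {a : Module.End Base WordModule}
    (h : ∀ (w : List ℤ) (x : Module.End Base WordModule) (z : WordModule), SerreElement opF x →
      a ((w.map opF).prod (x z)) ∈ serreSubspace) {y : WordModule} (hy : y ∈ serreSubspace) :
    a y ∈ serreSubspace := by
  have : serreSubspace ≤ serreSubspace.comap a := by
    refine Submodule.span_le.mpr ?_
    rintro _ ⟨w, x, z, hx, rfl⟩
    exact h w x z hx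
  exact this hy

lemma opF_mem (i : ℤ) {y : WordModule} (hy : y ∈ serreSubspace) : opF i y ∈ serreSubspace := by
  refine apply_mem_serreSubspace (fun w x z hx => ?_) hy
  have := word_mem_serreSubspace (i :: w) hx z
  rwa [List.map_cons, List.prod_cons, Module.End.mul_apply] at this

lemma qcomm_mem {k : Module.End Base WordModule} {s : ℤ → Base}
    (hk : ∀ j, QComm (s j) k (opF j)) {y : WordModule} (hy : y ∈ serreSubspace) :
    k y ∈ serreSubspace := by
  refine apply_mem_serreSubspace (fun w x z hx => ?_) hy
  induction w with
  | nil =>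
    obtain ⟨t, ht⟩ := hx.exists_qcomm hk
    have : k (x z) = t • x (k z) := LinearMap.congr_fun ht z
    rw [List.map_nil, List.prod_nil, Module.End.one_apply, this]
    exact Submodule.smul_mem _ _ (word_mem_serreSubspace [] hx (k z))
  | cons j w ih =>
    have : ∀ z, k (opF j z) = s j • opF j (k z) := LinearMap.congr_fun (hk j)
    rw [List.map_cons, List.prod_cons, Module.End.mul_apply, this]
    exact Submodule.smul_mem _ _ (opF_mem j ih)

lemma opK_mem (i : ℤ) {y : WordModule} (hy : y ∈ serreSubspace) : opK lam i y ∈ serreSubspace :=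
  qcomm_mem (opK_opF lam i) hy

lemma opKinv_mem (i : ℤ) {y : WordModule} (hy : y ∈ serreSubspace) :
    opKinv lam i y ∈ serreSubspace :=
  qcomm_mem ((weakRel lam).k'_f i) hy

/-- By the symmetry `WeakRel.symm`, Serre elements in the `F_j` commute with `E_i`. Passing `E_i`
through the letters in front adds only `K`-terms, which preserve the subspace. -/
lemma opE_mem (i : ℤ) {y : WordModule} (hy : y ∈ serreSubspace) : opE lam i y ∈ serreSubspace := by
  have hw := weakRel lam
  refine apply_mem_serreSubspace (fun w x z hx => ?_) hy
  induction w with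
  | nil =>
    have : x (opE lam i z) = opE lam i (x z) :=
      LinearMap.congr_fun (hw.symm.commute_serreElement hx i) z
    rw [List.map_nil, List.prod_nil, Module.End.one_apply, ← this]
    exact word_mem_serreSubspace [] hx (opE lam i z)
  | cons j w ih =>
    rw [List.map_cons, List.prod_cons, Module.End.mul_apply]
    by_cases hij : i = j
    · subst hij
      have h1 := LinearMap.congr_fun (hw.e_f_same i) ((w.map opF).prod (x z))
      rw [LinearMap.sub_apply, Module.End.mul_apply, Module.End.mul_apply, sub_eq_iff_eq_add] at h1
      rw [h1]
      have hmem := word_mem_serreSubspace w hx z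
      exact Submodule.add_mem _ (Submodule.smul_mem _ _ (Submodule.sub_mem _
        (opK_mem lam _ (opKinv_mem lam _ hmem)) (opK_mem lam _ (opKinv_mem lam _ hmem))))
        (opF_mem i ih)
    · have : opE lam i (opF j ((w.map opF).prod (x z))) =
          opF j (opE lam i ((w.map opF).prod (x z))) :=
        LinearMap.congr_fun (hw.e_f_ne i j hij) _
      rw [this]
      exact opF_mem j ih

/-- Every spanning vector is a sum of images of operators `opF i`, whose coefficient at the empty
word is zero. -/
lemma vec_nil_notMem : vec [] ∉ serreSubspace := by
  have hF : ∀ i, (Finsupp.lapply [] : WordModule →ₗ[Base] Base) ∘ₗ opF i = 0 := fun i =>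
    ext_words fun l => by simp
  have hF' : ∀ (i : ℤ) (x : WordModule), (opF i x) [] = 0 := fun i => LinearMap.congr_fun (hF i)
  have : serreSubspace ≤ LinearMap.ker (Finsupp.lapply [] : WordModule →ₗ[Base] Base) := by
    refine Submodule.span_le.mpr ?_
    rintro _ ⟨w, x, z, hx, rfl⟩
    cases w with
    | nil => cases hx <;> simp [hF', sq]
    | cons i w => simp [hF']
  intro h
  have := this h
  simp at this

/-- The action of the generators on words. -/
def opGen : Gen → Module.End Base WordModule
  | Gen.E i => opE lam i
  | Gen.F i => opF i
  | Gen.K i => opK lam i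
  | Gen.Kinv i => opKinv lam i

lemma opGen_mem (g : Gen) : serreSubspace ≤ serreSubspace.comap (opGen lam g) := by
  intro y hy
  cases g with
  | E i => exact opE_mem lam i hy
  | F i => exact opF_mem i hy
  | K i => exact opK_mem lam i hy
  | Kinv i => exact opKinv_mem lam i hy

/-- The action of the free algebra on words. -/
def freeAction : Free →ₐ[Base] Module.End Base WordModule := FreeAlgebra.lift Base (opGen lam)

end WordModule

open WordModule

/-- A highest weight module: the space of words modulo the Serre relations. -/
def SerreQuotient (_ : Weight) : Type := WordModule ⧸ serreSubspace

namespace SerreQuotient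

variable (lam : Weight)

instance : AddCommGroup (SerreQuotient lam) :=
  inferInstanceAs (AddCommGroup (WordModule ⧸ serreSubspace))

instance : Module Base (SerreQuotient lam) :=
  inferInstanceAs (Module Base (WordModule ⧸ serreSubspace))

/-- The projection from the space of words. -/
def proj : WordModule →ₗ[Base] SerreQuotient lam := serreSubspace.mkQ

lemma proj_surjective : Function.Surjective (proj lam) := Submodule.mkQ_surjective _

lemma proj_eq_zero {x : WordModule} : proj lam x = 0 ↔ x ∈ serreSubspace :=
  Submodule.Quotient.mk_eq_zero _

/-- The action of the generators on the quotient. -/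
def quotGen (g : Gen) : Module.End Base (SerreQuotient lam) :=
  serreSubspace.mapQ serreSubspace (opGen lam g) (opGen_mem lam g)

lemma quotGen_proj (g : Gen) (x : WordModule) :
    quotGen lam g (proj lam x) = proj lam (opGen lam g x) := rfl

/-- The action of the free algebra on the quotient. -/
def freeAction : Free →ₐ[Base] Module.End Base (SerreQuotient lam) :=
  FreeAlgebra.lift Base (quotGen lam)

lemma freeAction_proj (a : Free) (x : WordModule) :
    freeAction lam a (proj lam x) = proj lam (WordModule.freeAction lam a x) := by
  induction a using FreeAlgebra.induction generalizing x with
  | grade0 r =>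
    rw [AlgHom.commutes, AlgHom.commutes, Module.algebraMap_end_apply,
      Module.algebraMap_end_apply, map_smul]
  | grade1 g =>
    rw [freeAction, WordModule.freeAction, FreeAlgebra.lift_ι_apply, FreeAlgebra.lift_ι_apply,
      quotGen_proj]
  | mul a b ha hb => rw [map_mul, map_mul, Module.End.mul_apply, Module.End.mul_apply, hb, ha]
  | add a b ha hb => rw [map_add, map_add, LinearMap.add_apply, LinearMap.add_apply, ha, hb,
      map_add]

lemma freeAction_eq_of_sub_mem {a b : Free}
    (h : ∀ x, WordModule.freeAction lam (a - b) x ∈ serreSubspace) :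
    freeAction lam a = freeAction lam b := by
  rw [← sub_eq_zero, ← map_sub]
  refine LinearMap.ext fun y => ?_
  obtain ⟨x, rfl⟩ := proj_surjective lam y
  rw [freeAction_proj, LinearMap.zero_apply, proj_eq_zero]
  exact h x

lemma freeAction_gen (g : Gen) : WordModule.freeAction lam (gen g) = opGen lam g :=
  FreeAlgebra.lift_ι_apply _ _

/-- All relations already hold on words, except those among the `F_i` alone, which hold modulo
`serreSubspace`. -/
lemma freeAction_rel {a b : Free} (h : Rel a b) : freeAction lam a = freeAction lam b := by
  have hw := weakRel lam
  refine freeAction_eq_of_sub_mem lam fun x => ?_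
  have hzero : ∀ {c : Module.End Base WordModule}, c = 0 → c x ∈ serreSubspace := by
    rintro _ rfl
    exact Submodule.zero_mem _
  cases h with
  | K_comm i j =>
    apply hzero
    simp only [map_sub, map_mul, freeAction_gen, opGen]
    rw [hw.k_comm, sub_self]
  | K_mul_Kinv i =>
    apply hzero
    simp only [map_sub, map_mul, map_one, freeAction_gen, opGen]
    rw [hw.k_k', sub_self]
  | Kinv_mul_K i =>
    apply hzero
    simp only [map_sub, map_mul, map_one, freeAction_gen, opGen]
    rw [hw.k'_k, sub_self]
  | K_E i j =>
    apply hzero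
    simp only [map_sub, map_mul, map_smul, freeAction_gen, opGen]
    rw [hw.k_e, simpleRoot_apply, sub_self]
  | K_F i j =>
    apply hzero
    simp only [map_sub, map_mul, map_smul, freeAction_gen, opGen]
    rw [hw.k_f, simpleRoot_apply, neg_sub, sub_self]
  | E_comm i j hij =>
    apply hzero
    simp only [map_sub, map_mul, freeAction_gen, opGen]
    exact eq_zero_of_serreElement_opE lam (.comm i j hij)
  | F_comm i j hij =>
    simp only [map_sub, map_mul, freeAction_gen, opGen]
    exact word_mem_serreSubspace [] (.comm i j hij) x
  | E_F_same i =>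
    apply hzero
    simp only [map_sub, map_mul, map_smul, freeAction_gen, opGen]
    rw [hw.e_f_same, sub_self]
  | E_F_ne i j hij =>
    apply hzero
    simp only [sub_zero, map_sub, map_mul, freeAction_gen, opGen]
    rw [(hw.e_f_ne i j hij).eq, sub_self]
  | E_serre i j hij =>
    apply hzero
    simp only [sub_zero, map_add, map_sub, map_mul, map_pow, map_smul, freeAction_gen, opGen]
    exact eq_zero_of_serreElement_opE lam (.serre i j hij)
  | F_serre i j hij =>
    simp only [sub_zero, map_add, map_sub, map_mul, map_pow, map_smul, freeAction_gen, opGen]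
    exact word_mem_serreSubspace [] (.serre i j hij) x

/-- The action of `𝐔(∞)` on the quotient. -/
def action : U →ₐ[Base] Module.End Base (SerreQuotient lam) :=
  RingQuot.liftAlgHom Base ⟨freeAction lam, fun _ _ => freeAction_rel lam⟩

lemma action_mkU (a : Free) : action lam (mkU a) = freeAction lam a :=
  RingQuot.liftAlgHom_mkAlgHom_apply _ _ _ _

/-- The underlying space is the same for all weights; the parameter of `SerreQuotient` keeps the
different actions apart. -/
instance : Module U (SerreQuotient lam) := Module.compHom _ (action lam).toRingHom

lemma smul_def (a : U) (x : SerreQuotient lam) : a • x = action lam a x := rfl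

instance : IsScalarTower Base U (SerreQuotient lam) :=
  ⟨fun c a x => by rw [smul_def, smul_def, map_smul, LinearMap.smul_apply]⟩

lemma gen_smul (g : Gen) (x : WordModule) :
    mkU (gen g) • proj lam x = proj lam (opGen lam g x) := by
  rw [smul_def, action_mkU, freeAction_proj, freeAction_gen]

lemma isSingular : IsSingular lam (proj lam (vec [])) where
  mem i := by
    rw [K, gen_smul, opGen, opK_vec, map_smul, wt_nil, sub_zero]
  E_smul i := by
    rw [E, gen_smul, opGen, opE_nil, map_zero]

lemma proj_vec_nil_ne_zero : proj lam (vec []) ≠ 0 := fun h =>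
  vec_nil_notMem ((proj_eq_zero lam).mp h)

end SerreQuotient

/-! ### Verma modules and their simple quotients -/

section Verma

/-- The canonical generator of the Verma module. -/
def vermaVec (lam : Weight) : Verma lam := (vermaIdeal lam).mkQ 1

lemma smul_vermaVec (lam : Weight) (a : U) : a • vermaVec lam = (vermaIdeal lam).mkQ a := by
  rw [vermaVec, ← map_smul, smul_eq_mul, mul_one]

variable {M : Type v} [AddCommGroup M] [Module Base M] [Module U M] [IsScalarTower Base U M]
variable {lam mu : Weight} {v : M}

lemma IsSingular.vermaIdeal_le (h : IsSingular lam v) :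
    vermaIdeal lam ≤ LinearMap.ker (LinearMap.toSpanSingleton U M v) := by
  refine Submodule.span_le.mpr ?_
  rintro _ (⟨i, rfl⟩ | ⟨i, rfl⟩)
  · exact h.E_smul i
  · change (K i - algebraMap Base U (ups ^ lam i)) • v = 0
    rw [sub_smul, algebraMap_smul, h.mem i, sub_self]

/-- The map from the Verma module given by a singular vector. -/
def IsSingular.vermaMap (h : IsSingular lam v) : Verma lam →ₗ[U] M :=
  (vermaIdeal lam).liftQ (LinearMap.toSpanSingleton U M v) h.vermaIdeal_le

lemma IsSingular.vermaMap_vermaVec (h : IsSingular lam v) : h.vermaMap (vermaVec lam) = v := by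
  simp [vermaMap, vermaVec]

lemma isHighestWeight_vermaVec (lam : Weight) : IsHighestWeight lam (vermaVec lam) where
  mem i := by
    rw [smul_vermaVec, ← sub_eq_zero, ← algebraMap_smul U, smul_vermaVec, ← map_sub]
    exact (Submodule.Quotient.mk_eq_zero _).mpr (Submodule.subset_span (Or.inr ⟨i, rfl⟩))
  E_smul i := by
    rw [smul_vermaVec]
    exact (Submodule.Quotient.mk_eq_zero _).mpr (Submodule.subset_span (Or.inl ⟨i, rfl⟩))
  ne_zero h := by
    -- The generator maps to the nonzero class of the empty word, so it is nonzero.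
    have := (SerreQuotient.isSingular lam).vermaMap_vermaVec
    rw [h, map_zero] at this
    exact SerreQuotient.proj_vec_nil_ne_zero lam this.symm
  span := by
    rw [eq_top_iff]
    intro x _
    obtain ⟨a, rfl⟩ := (vermaIdeal lam).mkQ_surjective x
    exact Submodule.mem_span_singleton.mpr ⟨a, smul_vermaVec lam a⟩

lemma isCoatom_maxSubmodule (lam : Weight) : IsCoatom (maxSubmodule lam) :=
  (isHighestWeight_vermaVec lam).isCoatom_sSup

instance isSimpleModule_L (lam : Weight) : IsSimpleModule U (L lam) :=
  isSimpleModule_iff_isCoatom.mpr (isCoatom_maxSubmodule lam)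

/-- The canonical generator of `L(λ)`. -/
def simpleVec (lam : Weight) : L lam := (maxSubmodule lam).mkQ (vermaVec lam)

lemma isHighestWeight_simpleVec (lam : Weight) : IsHighestWeight lam (simpleVec lam) := by
  have h := isHighestWeight_vermaVec lam
  refine h.map _ (Submodule.mkQ_surjective _) fun h0 => h.sSup_ne_top ?_
  exact (h.eq_top_iff_mem _).mpr ((Submodule.Quotient.mk_eq_zero _).mp h0)

/-- A simple module with a highest weight vector of weight `λ` is `L(λ)`. -/
lemma IsHighestWeight.nonempty_equiv_L [IsSimpleModule U M] (h : IsHighestWeight lam v) :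
    Nonempty (L lam ≃ₗ[U] M) := by
  set f := h.vermaMap with hf
  have hfv : f (vermaVec lam) = v := h.vermaMap_vermaVec
  have hsurj : Function.Surjective f := by
    rw [← LinearMap.range_eq_top, h.eq_top_iff_mem]
    exact ⟨_, hfv⟩
  have hker : LinearMap.ker f = maxSubmodule lam := by
    have hne : LinearMap.ker f ≠ ⊤ := fun htop => h.ne_zero <| by
      rw [← hfv]
      exact LinearMap.mem_ker.mp (by rw [htop]; trivial)
    have hle : LinearMap.ker f ≤ maxSubmodule lam := le_sSup hne
    -- The quotient by the kernel is the simple module `M`, so the kernel is maximal; being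
    -- contained in the proper `maxSubmodule lam`, it equals it.
    have hco : IsCoatom (LinearMap.ker f) := by
      rw [← isSimpleModule_iff_isCoatom]
      exact IsSimpleModule.congr (f.quotKerEquivOfSurjective hsurj)
    exact hco.le_iff_eq (isCoatom_maxSubmodule lam).1 |>.mp hle |>.symm
  exact ⟨(Submodule.quotEquivOfEq _ _ hker.symm).trans (f.quotKerEquivOfSurjective hsurj)⟩

lemma isIntegrable_L_iff (lam : Weight) : IsIntegrable (L lam) ↔ lam ∈ dominant :=
  ⟨(isHighestWeight_simpleVec lam).dominant_of_isIntegrable,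
    (isHighestWeight_simpleVec lam).isIntegrable⟩

end Verma

/-! ### Isomorphism classes -/

section Categories

open scoped ModuleCat.Algebra

/-- The comparison of `L(λ)` with the corresponding object of the category of modules. -/
def equivLobj (lam : Weight) : L lam ≃ₗ[U] (Lobj.{u} lam : ModuleCat.{u} U) :=
  ULift.moduleEquiv.symm

lemma isoClass_eq_iff {M N : ModuleCat.{u} U} :
    isoClass M = isoClass N ↔ Nonempty (M ≃ₗ[U] N) := by
  rw [isoClass, isoClass, Quotient.eq]
  exact ⟨fun ⟨e⟩ => ⟨e.toLinearEquiv⟩, fun ⟨e⟩ => ⟨e.toModuleIso⟩⟩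

lemma injective_isoClass_Lobj : Function.Injective fun lam => isoClass (Lobj.{u} lam) := by
  intro lam mu h
  obtain ⟨e⟩ := isoClass_eq_iff.mp h
  let e' : L lam ≃ₗ[U] L mu := ((equivLobj lam).trans e).trans (equivLobj mu).symm
  have hlam := isHighestWeight_simpleVec lam
  exact (hlam.map e'.toLinearMap e'.surjective
    fun h0 => hlam.ne_zero (by simpa using h0)).weight_unique (isHighestWeight_simpleVec mu)

/-- The classification of irreducible integrable modules in a full subcategory that lies in
`𝒞^hi` and contains all `L(λ)` with `λ` dominant. -/
lemma bijOn_isoClass_Lobj (P : ObjectProperty (ModuleCat.{u} U)) (hP : P ≤ Chi)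
    (hL : ∀ lam ∈ dominant, P (Lobj.{u} lam)) :
    Set.BijOn (fun lam => isoClass (Lobj.{u} lam)) dominant (irrClasses (Cint.{u} ⊓ P)) := by
  refine ⟨fun lam hlam => ⟨Lobj lam, ⟨?_, hL lam hlam⟩, ?_, rfl⟩,
    injective_isoClass_Lobj.injOn, ?_⟩
  · exact IsIntegrable.of_surjective ((isIntegrable_L_iff lam).mpr hlam)
      (equivLobj lam).toLinearMap (equivLobj lam).surjective
  · exact IsSimpleModule.congr (equivLobj lam).symm
  · rintro _ ⟨M, ⟨hint, hPM⟩, hsimple, rfl⟩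
    have hhi : IsHi M := hP M hPM
    obtain ⟨lam, v, hv⟩ := hhi.exists_isHighestWeight
    obtain ⟨e⟩ := hv.nonempty_equiv_L
    exact ⟨lam, hv.dominant_of_isIntegrable hint,
      isoClass_eq_iff.mpr ⟨(equivLobj lam).symm.trans e⟩⟩

lemma catO_Lobj (lam : Weight) : CatO (Lobj.{u} lam) :=
  IsCatO.of_equiv (isHighestWeight_simpleVec lam).isCatO (equivLobj lam)

lemma catO_le_chi : CatO.{u} ≤ Chi := fun _ h => IsCatO.isHi h

end Categories

end QuantumGLInf
end

theorem mainTheorem8 :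
    Set.BijOn (fun lam => QuantumGLInf.isoClass (QuantumGLInf.Lobj.{u} lam))
        QuantumGLInf.dominant
        (QuantumGLInf.irrClasses (QuantumGLInf.Cint.{u} ⊓ QuantumGLInf.Chi.{u})) ∧
      Set.BijOn (fun lam => QuantumGLInf.isoClass (QuantumGLInf.Lobj.{u} lam))
        QuantumGLInf.dominant
        (QuantumGLInf.irrClasses (QuantumGLInf.Cint.{u} ⊓ QuantumGLInf.CatO.{u})) ∧
      ∀ lam : QuantumGLInf.Weight,
        QuantumGLInf.IsIntegrable (QuantumGLInf.L lam) ↔ lam ∈ QuantumGLInf.dominant :=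
  ⟨QuantumGLInf.bijOn_isoClass_Lobj _ le_rfl fun lam _ =>
      QuantumGLInf.catO_le_chi _ (QuantumGLInf.catO_Lobj lam),
    QuantumGLInf.bijOn_isoClass_Lobj _ QuantumGLInf.catO_le_chi
      fun lam _ => QuantumGLInf.catO_Lobj lam,
    QuantumGLInf.isIntegrable_L_iff⟩
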